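/- Let $K$ be any field and $E=(E_0,E_1,s,r)$ any directed graph, and let $L_K(E)$ be its Leavitt path algebra. A cycle in $E$ is a closed path $e_1\cdots e_n$ ($n\ge 1$) with $s(e_i)\neq s(e_j)$ for $i\neq j$; it is exclusive if every cycle having a vertex in common with it is one of its cyclic permutations. A polynomial $p(x)\in K[x]$ is basic irreducible if it is irreducible, $\deg p(x)\geq 2$ and $p(0)=-1$. For a cycle $c$ with first edge $c_1$ and a field $F$, let $V_{[c^\infty]}$ be the left $L_F(E)$-module with $F$-basis the set $[c^\infty]$ of all infinite paths $\lambda c^\infty$, $\lambda$ a finite path, where for a vertex $v$, an edge $f$ and $\mathfrak q=f_1f_2\cdots\in[c^\infty]$: $v\mathfrak q=\mathfrak q$ if $v=s(f_1)$ and $0$ otherwise; $f\mathfrak q=ff_1f_2\cdots$ if $r(f)=s(f_1)$ and $0$ otherwise; $f^*\mathfrak q=f_2f_3\cdots$ if $f=f_1$ and $0$ otherwise. For $0\ne a\in F$ let $\sigma_{c,a}$ be the automorphism of $L_F(E)$ sending $c_1\mapsto ac_1$, $c_1^*\mapsto a^{-1}c_1^*$ and fixing all vertices and all other edges and ghost edges.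 For a basic irreducible $p(x)\in K[x]$, put $K'=K[x]/\langle p(x)\rangle$ and $\overline x=x+\langle p(x)\rangle$; then $V^p_{[c^\infty]}$ is the left $L_K(E)$-module obtained by restricting scalars from $L_{K'}(E)$ to $L_K(E)$ in the module $V_{[c^\infty]}$ over $L_{K'}(E)$ with the twisted action $\ell\star m=\sigma_{c,\overline x}(\ell)m$. Theorem. Let $c$ and $e$ be cycles in $E$ such that there is a (possibly trivial) path in $E$ from $s(c)$ to $s(e)$, and let $p(x),q(x)\in K[x]$ be basic irreducible polynomials. If $c$ and $e$ are not both exclusive, then \[\dim_K \mathrm{Ext}^1\big(V^p_{[c^\infty]},V^q_{[e^\infty]}\big)=\infty,\] where $\mathrm{Ext}^1$ is taken in the category of unital left $L_K(E)$-modules (the modules $M$ with $L_K(E)M=M$). -/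

import Mathlib

open CategoryTheory Polynomial

universe u v w t

/-! ## Directed graphs, cycles, infinite paths -/

/-- An arbitrary directed graph: vertices, edges, source and range (multiple edges and loops are
allowed, there is no finiteness condition). -/
structure DirGraph where
  V : Type u
  E : Type v
  s : E → V
  r : E → V

namespace DirGraph

/-- There is a finite path (possibly of length zero) from the first vertex to the second. -/
def Reaches (G : DirGraph.{u, v}) : G.V → G.V → Prop :=
  Relation.ReflTransGen fun a b => ∃ f : G.E, G.s f = a ∧ G.r f = b

/-- A cycle `e₁ ⋯ eₙ`, `n ≥ 1`: a closed path whose edges have pairwise distinct sources. -/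
structure Cyc (G : DirGraph.{u, v}) where
  edges : List G.E
  ne_nil : edges ≠ []
  chain : edges.IsChain fun f g => G.r f = G.s g
  closed : G.r (edges.getLast ne_nil) = G.s (edges.head ne_nil)
  nodup : (edges.map G.s).Nodup

section Paths

variable {G : DirGraph.{u, v}}

namespace Cyc

lemma length_pos (c : G.Cyc) : 0 < c.edges.length := List.length_pos_iff.mpr c.ne_nil

/-- The first edge of the cycle. -/
def first (c : G.Cyc) : G.E := c.edges.head c.ne_nil

/-- The source of the cycle. -/
def base (c : G.Cyc) : G.V := G.s c.first

/-- The sequence of edges of the infinite path `c^∞ = c c c ⋯`. -/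
def inf (c : G.Cyc) (i : ℕ) : G.E :=
  c.edges[i % c.edges.length]'(Nat.mod_lt _ c.length_pos)

/-- A cycle is exclusive if every cycle having a vertex in common with it is one of its cyclic
permutations. -/
def IsExclusive (c : G.Cyc) : Prop :=
  ∀ d : G.Cyc, (∃ f ∈ c.edges, ∃ g ∈ d.edges, G.s f = G.s g) → d.edges ~r c.edges

end Cyc

/-- The set `[c^∞]` of the infinite paths of the form `λ c^∞` with `λ` a finite path (namely the
path formed by the first `m` edges, for some `m`). -/
@[ext]
structure TailClass (c : G.Cyc) : Type (max u v) where
  seq : ℕ → G.E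
  chain : ∀ n, G.r (seq n) = G.s (seq (n + 1))
  tail : ∃ m, ∀ i, seq (m + i) = c.inf i

namespace TailClass

variable {c : G.Cyc}

/-- The source of an infinite path. -/
def src (q : TailClass c) : G.V := G.s (q.seq 0)

/-- The infinite path `f q`. -/
def cons (f : G.E) (q : TailClass c) (h : G.r f = q.src) : TailClass c where
  seq n := Nat.casesOn n f q.seq
  chain n := by
    cases n with
    | zero => exact h
    | succ n => exact q.chain n
  tail := by
    obtain ⟨m, hm⟩ := q.tail
    exact ⟨m + 1, fun i => by rw [Nat.add_right_comm]; exact hm i⟩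

/-- The infinite path obtained by removing the first edge. -/
def drop (q : TailClass c) : TailClass c where
  seq n := q.seq (n + 1)
  chain n := q.chain (n + 1)
  tail := by
    obtain ⟨m, hm⟩ := q.tail
    have hl := c.length_pos
    refine ⟨m + (c.edges.length - 1), fun i => ?_⟩
    have h1 : m + (c.edges.length - 1) + i + 1 = m + (c.edges.length + i) := by omega
    rw [h1, hm]
    simp [Cyc.inf]

lemma drop_cons (f : G.E) (q : TailClass c) (h : G.r f = q.src) : (q.cons f h).drop = q := rfl

lemma src_drop (q : TailClass c) : q.drop.src = G.r (q.seq 0) := (q.chain 0).symm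

lemma cons_drop (q : TailClass c) : q.drop.cons (q.seq 0) q.src_drop.symm = q := by
  ext n
  cases n <;> rfl

end TailClass

end Paths

/-! ## The Leavitt path algebra -/

/-- The vertices, the edges and the ghost edges `f*`. -/
inductive Gen (G : DirGraph.{u, v}) : Type (max u v)
  | vertex (x : G.V)
  | edge (f : G.E)
  | ghost (f : G.E)

/-- The defining relations of the Leavitt path algebra, for a family of elements of a (not
necessarily unital) ring indexed by the vertices, the edges and the ghost edges: the relations of
the path algebra of the double graph, and the Cuntz-Krieger relations CK1 and CK2. -/
structure IsLeavittFamily (G : DirGraph.{u, v}) {A : Type t} [NonUnitalSemiring A]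
    (φ : Gen G → A) : Prop where
  vertex_mul_self : ∀ x, φ (.vertex x) * φ (.vertex x) = φ (.vertex x)
  vertex_mul_of_ne : ∀ x y, x ≠ y → φ (.vertex x) * φ (.vertex y) = 0
  source_mul_edge : ∀ f, φ (.vertex (G.s f)) * φ (.edge f) = φ (.edge f)
  edge_mul_range : ∀ f, φ (.edge f) * φ (.vertex (G.r f)) = φ (.edge f)
  range_mul_ghost : ∀ f, φ (.vertex (G.r f)) * φ (.ghost f) = φ (.ghost f)
  ghost_mul_source : ∀ f, φ (.ghost f) * φ (.vertex (G.s f)) = φ (.ghost f)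
  ghost_mul_edge_self : ∀ f, φ (.ghost f) * φ (.edge f) = φ (.vertex (G.r f))
  ghost_mul_edge_of_ne : ∀ f g, f ≠ g → φ (.ghost f) * φ (.edge g) = 0
  sum_edge_mul_ghost : ∀ (x : G.V) (T : Finset G.E), T.Nonempty → (∀ f, f ∈ T ↔ G.s f = x) →
    ∑ f ∈ T, φ (.edge f) * φ (.ghost f) = φ (.vertex x)

variable (R : Type w) [CommRing R] (G : DirGraph.{u, v})

/-- The free associative (non-unital) `R`-algebra on the vertices, edges and ghost edges. -/
abbrev FreeAlg : Type (max u v w) := MonoidAlgebra R (FreeSemigroup (Gen G))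

/-- The generators of the free algebra. -/
noncomputable def FreeAlg.gen (x : Gen G) : FreeAlg R G := MonoidAlgebra.single (.of x) 1

/-- The pairs of elements of the free algebra identified by the defining relations. -/
inductive LeavittRel : FreeAlg R G → FreeAlg R G → Prop
  | vertex_mul_self (x : G.V) : LeavittRel
      (FreeAlg.gen R G (.vertex x) * FreeAlg.gen R G (.vertex x)) (FreeAlg.gen R G (.vertex x))
  | vertex_mul_of_ne (x y : G.V) : x ≠ y → LeavittRel
      (FreeAlg.gen R G (.vertex x) * FreeAlg.gen R G (.vertex y)) 0
  | source_mul_edge (f : G.E) : LeavittRel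
      (FreeAlg.gen R G (.vertex (G.s f)) * FreeAlg.gen R G (.edge f)) (FreeAlg.gen R G (.edge f))
  | edge_mul_range (f : G.E) : LeavittRel
      (FreeAlg.gen R G (.edge f) * FreeAlg.gen R G (.vertex (G.r f))) (FreeAlg.gen R G (.edge f))
  | range_mul_ghost (f : G.E) : LeavittRel
      (FreeAlg.gen R G (.vertex (G.r f)) * FreeAlg.gen R G (.ghost f)) (FreeAlg.gen R G (.ghost f))
  | ghost_mul_source (f : G.E) : LeavittRel
      (FreeAlg.gen R G (.ghost f) * FreeAlg.gen R G (.vertex (G.s f))) (FreeAlg.gen R G (.ghost f))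
  | ghost_mul_edge_self (f : G.E) : LeavittRel
      (FreeAlg.gen R G (.ghost f) * FreeAlg.gen R G (.edge f)) (FreeAlg.gen R G (.vertex (G.r f)))
  | ghost_mul_edge_of_ne (f g : G.E) : f ≠ g → LeavittRel
      (FreeAlg.gen R G (.ghost f) * FreeAlg.gen R G (.edge g)) 0
  | sum_edge_mul_ghost (x : G.V) (T : Finset G.E) : T.Nonempty → (∀ f, f ∈ T ↔ G.s f = x) →
      LeavittRel (∑ f ∈ T, FreeAlg.gen R G (.edge f) * FreeAlg.gen R G (.ghost f))
        (FreeAlg.gen R G (.vertex x))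

/-- The congruence of (non-unital) `R`-algebras generated by the defining relations. -/
noncomputable def leavittCon : RingCon (FreeAlg R G) :=
  ringConGen fun a b => ∃ (k : R) (x y : FreeAlg R G), LeavittRel R G x y ∧ a = k • x ∧ b = k • y

/-- The Leavitt path algebra `L_R(G)`, as a non-unital ring. -/
def LPA : Type (max u v w) := (leavittCon R G).Quotient

namespace LPA

noncomputable instance : NonUnitalRing (LPA R G) :=
  inferInstanceAs (NonUnitalRing (leavittCon R G).Quotient)

variable {R G}

/-- The class of an element of the free algebra. -/
noncomputable def mk (a : FreeAlg R G) : LPA R G := RingCon.toQuotient (c := leavittCon R G) a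

lemma mk_surjective : Function.Surjective (mk (R := R) (G := G)) := Quotient.mk''_surjective

lemma mk_add (a b : FreeAlg R G) : mk (a + b) = mk a + mk b := rfl

lemma mk_mul (a b : FreeAlg R G) : mk (a * b) = mk a * mk b := rfl

lemma mk_zero : mk (0 : FreeAlg R G) = 0 := rfl

lemma leavittCon_smul (k : R) {a b : FreeAlg R G} (h : leavittCon R G a b) :
    leavittCon R G (k • a) (k • b) := by
  change RingConGen.Rel _ _ _ at h
  change RingConGen.Rel _ _ _
  induction h with
  | of x y h =>
    obtain ⟨l, x', y', h, rfl, rfl⟩ := h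
    exact .of _ _ ⟨k * l, x', y', h, by rw [mul_smul], by rw [mul_smul]⟩
  | refl x => exact .refl _
  | symm _ ih => exact ih.symm
  | trans _ _ ih₁ ih₂ => exact ih₁.trans ih₂
  | add _ _ ih₁ ih₂ => rw [smul_add, smul_add]; exact ih₁.add ih₂
  | mul _ h₂ ih₁ _ => rw [← smul_mul_assoc, ← smul_mul_assoc]; exact ih₁.mul h₂

variable {S : Type*} [CommSemiring S] [Algebra S R]

noncomputable instance : SMul S (LPA R G) :=
  ⟨(leavittCon R G).smulAux fun k a b h => by
    rw [← algebraMap_smul R k a, ← algebraMap_smul R k b]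
    exact leavittCon_smul _ h⟩

lemma mk_smul (k : S) (a : FreeAlg R G) : mk (k • a) = k • mk a := rfl

/-- The `S`-module structure on `L_R(G)` for every `S`-algebra `R`, in particular for `S = R`. -/
noncomputable instance : Module S (LPA R G) :=
  Function.Surjective.module S
    (⟨⟨mk, mk_zero⟩, mk_add⟩ : FreeAlg R G →+ LPA R G) mk_surjective mk_smul

instance : IsScalarTower S (LPA R G) (LPA R G) where
  smul_assoc k a b := by
    obtain ⟨a, rfl⟩ := mk_surjective a
    obtain ⟨b, rfl⟩ := mk_surjective b
    simp only [smul_eq_mul, ← mk_smul, ← mk_mul, smul_mul_assoc]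

instance : SMulCommClass S (LPA R G) (LPA R G) where
  smul_comm k a b := by
    obtain ⟨a, rfl⟩ := mk_surjective a
    obtain ⟨b, rfl⟩ := mk_surjective b
    simp only [smul_eq_mul, ← mk_smul, ← mk_mul, mul_smul_comm]

variable (R) in
/-- The vertices, edges and ghost edges as elements of the Leavitt path algebra. -/
noncomputable def gen (x : Gen G) : LPA R G := mk (FreeAlg.gen R G x)

lemma mk_eq_of_rel {a b : FreeAlg R G} (h : LeavittRel R G a b) : mk a = mk b :=
  Quotient.sound (s := (leavittCon R G).toSetoid)
    (RingConGen.Rel.of a b ⟨1, a, b, h, (one_smul _ _).symm, (one_smul _ _).symm⟩)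

lemma mk_sum {ι : Type*} (T : Finset ι) (a : ι → FreeAlg R G) :
    mk (∑ i ∈ T, a i) = ∑ i ∈ T, mk (a i) :=
  map_sum (⟨⟨mk, mk_zero⟩, mk_add⟩ : FreeAlg R G →+ LPA R G) _ _

/-- The generators satisfy the defining relations. -/
lemma isLeavittFamily_gen : IsLeavittFamily G (gen R (G := G)) where
  vertex_mul_self x := mk_eq_of_rel (.vertex_mul_self x)
  vertex_mul_of_ne x y h := mk_eq_of_rel (.vertex_mul_of_ne x y h)
  source_mul_edge f := mk_eq_of_rel (.source_mul_edge f)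
  edge_mul_range f := mk_eq_of_rel (.edge_mul_range f)
  range_mul_ghost f := mk_eq_of_rel (.range_mul_ghost f)
  ghost_mul_source f := mk_eq_of_rel (.ghost_mul_source f)
  ghost_mul_edge_self f := mk_eq_of_rel (.ghost_mul_edge_self f)
  ghost_mul_edge_of_ne f g h := mk_eq_of_rel (.ghost_mul_edge_of_ne f g h)
  sum_edge_mul_ghost x T hT h := by
    have := mk_eq_of_rel (.sum_edge_mul_ghost (R := R) x T hT h)
    rwa [mk_sum] at this

section lift

variable {A : Type t} [NonUnitalRing A] [Module S A] [IsScalarTower S A A] [SMulCommClass S A A]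

/-- The homomorphism from the free algebra given by a family. -/
noncomputable def freeLift {S : Type*} [CommRing S] [Module S A] [IsScalarTower S A A]
    [SMulCommClass S A A] (φ : Gen G → A) : FreeAlg S G →ₙₐ[S] A :=
  MonoidAlgebra.liftMagma S (FreeSemigroup.lift φ)

lemma freeLift_gen {S : Type*} [CommRing S] [Module S A] [IsScalarTower S A A]
    [SMulCommClass S A A] (φ : Gen G → A) (x : Gen G) :
    freeLift (S := S) φ (FreeAlg.gen S G x) = φ x := by
  simp [freeLift, FreeAlg.gen]

lemma freeLift_eq [Module R A] [IsScalarTower R A A] [SMulCommClass R A A] {φ : Gen G → A}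
    (hφ : IsLeavittFamily G φ) {a b : FreeAlg R G} (h : leavittCon R G a b) :
    freeLift (S := R) φ a = freeLift φ b := by
  change RingConGen.Rel _ _ _ at h
  induction h with
  | of x y h =>
    obtain ⟨k, x, y, h, rfl, rfl⟩ := h
    rw [map_smul, map_smul]
    congr 1
    cases h with
    | vertex_mul_self x => simpa [freeLift_gen] using hφ.vertex_mul_self x
    | vertex_mul_of_ne x y h => simpa [freeLift_gen] using hφ.vertex_mul_of_ne x y h
    | source_mul_edge f => simpa [freeLift_gen] using hφ.source_mul_edge f
    | edge_mul_range f => simpa [freeLift_gen] using hφ.edge_mul_range f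
    | range_mul_ghost f => simpa [freeLift_gen] using hφ.range_mul_ghost f
    | ghost_mul_source f => simpa [freeLift_gen] using hφ.ghost_mul_source f
    | ghost_mul_edge_self f => simpa [freeLift_gen] using hφ.ghost_mul_edge_self f
    | ghost_mul_edge_of_ne f g h => simpa [freeLift_gen] using hφ.ghost_mul_edge_of_ne f g h
    | sum_edge_mul_ghost x T hT h =>
      simpa [freeLift_gen, map_sum] using hφ.sum_edge_mul_ghost x T hT h
  | refl x => rfl
  | symm _ ih => exact ih.symm
  | trans _ _ ih₁ ih₂ => exact ih₁.trans ih₂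
  | add _ _ ih₁ ih₂ => rw [map_add, map_add, ih₁, ih₂]
  | mul _ _ ih₁ ih₂ => rw [map_mul, map_mul, ih₁, ih₂]

/-- The homomorphism from the Leavitt path algebra given by a family satisfying the defining
relations. -/
noncomputable def lift [Module R A] [IsScalarTower R A A] [SMulCommClass R A A] (φ : Gen G → A)
    (hφ : IsLeavittFamily G φ) : LPA R G →ₙₐ[R] A where
  toFun := Quotient.lift (s := (leavittCon R G).toSetoid) (freeLift (S := R) φ)
    fun _ _ h => freeLift_eq hφ h
  map_smul' k a := by
    obtain ⟨a, rfl⟩ := mk_surjective a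
    exact map_smul (freeLift (S := R) φ) k a
  map_zero' := map_zero (freeLift (S := R) φ)
  map_add' a b := by
    obtain ⟨a, rfl⟩ := mk_surjective a
    obtain ⟨b, rfl⟩ := mk_surjective b
    exact map_add (freeLift (S := R) φ) a b
  map_mul' a b := by
    obtain ⟨a, rfl⟩ := mk_surjective a
    obtain ⟨b, rfl⟩ := mk_surjective b
    exact map_mul (freeLift (S := R) φ) a b

@[simp]
lemma lift_gen [Module R A] [IsScalarTower R A A] [SMulCommClass R A A] (φ : Gen G → A)
    (hφ : IsLeavittFamily G φ) (x : Gen G) : lift (R := R) φ hφ (gen R x) = φ x :=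
  freeLift_gen φ x

end lift

/-- A property that holds for the generators and is stable under the operations holds for all
elements of the Leavitt path algebra. -/
lemma induction {P : LPA R G → Prop} (hgen : ∀ x, P (gen R x))
    (hsmul : ∀ (k : R) a, P a → P (k • a)) (hadd : ∀ a b, P a → P b → P (a + b))
    (hmul : ∀ a b, P a → P b → P (a * b)) (hzero : P 0) (a : LPA R G) : P a := by
  obtain ⟨a, rfl⟩ := mk_surjective a
  have hw : ∀ x : FreeSemigroup (Gen G), P (mk (MonoidAlgebra.single x 1)) := by
    intro x
    induction x using FreeSemigroup.recOnMul with
    | ih1 x => exact hgen x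
    | ih2 x y hx hy =>
      have := hmul _ _ hx hy
      rwa [← mk_mul, MonoidAlgebra.single_mul_single, one_mul] at this
  induction a using MonoidAlgebra.induction_linear with
  | zero => exact hzero
  | add a b ha hb => exact hadd _ _ ha hb
  | single x k =>
    have := hsmul k _ (hw x)
    rwa [← mk_smul, MonoidAlgebra.smul_single, smul_eq_mul, mul_one] at this

/-- The sum of the vertices in a finite set. -/
noncomputable def unit (R : Type w) [CommRing R] {G : DirGraph.{u, v}} (F : Finset G.V) :
    LPA R G := ∑ x ∈ F, gen R (.vertex x)

/-- The finite sums of vertices are local units (on the left). -/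
lemma exists_unit_mul (a : LPA R G) :
    ∃ F : Finset G.V, ∀ F', F ⊆ F' → unit R F' * a = a := by
  classical
  have key : ∀ (x : G.V) (a : LPA R G), gen R (.vertex x) * a = a →
      ∀ F' : Finset G.V, {x} ⊆ F' → unit R F' * a = a := by
    intro x a ha F' hF
    have hx : x ∈ F' := hF (Finset.mem_singleton_self x)
    rw [← ha, ← mul_assoc, unit, Finset.sum_mul, Finset.sum_eq_single_of_mem x hx,
      isLeavittFamily_gen.vertex_mul_self]
    intro y _ hy
    exact isLeavittFamily_gen.vertex_mul_of_ne y x hy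
  induction a using induction with
  | hgen x =>
    cases x with
    | vertex x => exact ⟨{x}, key x _ (isLeavittFamily_gen.vertex_mul_self x)⟩
    | edge f => exact ⟨{G.s f}, key _ _ (isLeavittFamily_gen.source_mul_edge f)⟩
    | ghost f => exact ⟨{G.r f}, key _ _ (isLeavittFamily_gen.range_mul_ghost f)⟩
  | hsmul k a h =>
    obtain ⟨F, hF⟩ := h
    exact ⟨F, fun F' h => by rw [mul_smul_comm, hF F' h]⟩
  | hadd a b ha hb =>
    obtain ⟨F₁, h₁⟩ := ha
    obtain ⟨F₂, h₂⟩ := hb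
    exact ⟨F₁ ∪ F₂, fun F' h => by
      rw [mul_add, h₁ F' (Finset.union_subset_left h), h₂ F' (Finset.union_subset_right h)]⟩
  | hmul a b ha _ =>
    obtain ⟨F₁, h₁⟩ := ha
    exact ⟨F₁, fun F' h => by rw [← mul_assoc, h₁ F' h]⟩
  | hzero => exact ⟨∅, fun F' _ => mul_zero _⟩

/-- The natural homomorphism `L_S(G) → L_R(G)` for an `S`-algebra `R`. -/
noncomputable def baseChange (S : Type*) [CommRing S] (R : Type w) [CommRing R] [Algebra S R]
    (G : DirGraph.{u, v}) : LPA S G →ₙₐ[S] LPA R G :=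
  lift (gen R) isLeavittFamily_gen

open Classical in
/-- The images of the generators under the gauge automorphism. -/
noncomputable def gaugeFun (c : G.Cyc) (a : Rˣ) : Gen G → LPA R G
  | .vertex x => gen R (.vertex x)
  | .edge f => (if f = c.first then (a : R) else 1) • gen R (.edge f)
  | .ghost f => (if f = c.first then ((a⁻¹ : Rˣ) : R) else 1) • gen R (.ghost f)

lemma isLeavittFamily_gaugeFun (c : G.Cyc) (a : Rˣ) : IsLeavittFamily G (gaugeFun c a) := by
  classical
  have h := isLeavittFamily_gen (R := R) (G := G)
  refine ⟨h.vertex_mul_self, h.vertex_mul_of_ne, fun f => ?_, fun f => ?_, fun f => ?_,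
    fun f => ?_, fun f => ?_, fun f g hfg => ?_, fun x T hT hx => ?_⟩
  · simp only [gaugeFun, mul_smul_comm, h.source_mul_edge]
  · simp only [gaugeFun, smul_mul_assoc, h.edge_mul_range]
  · simp only [gaugeFun, mul_smul_comm, h.range_mul_ghost]
  · simp only [gaugeFun, smul_mul_assoc, h.ghost_mul_source]
  · simp only [gaugeFun, mul_smul_comm, smul_mul_assoc, h.ghost_mul_edge_self, smul_smul]
    split_ifs <;> simp
  · simp only [gaugeFun, mul_smul_comm, smul_mul_assoc, h.ghost_mul_edge_of_ne f g hfg, smul_zero]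
  · simp only [gaugeFun]
    rw [← h.sum_edge_mul_ghost x T hT hx]
    refine Finset.sum_congr rfl fun f _ => ?_
    simp only [mul_smul_comm, smul_mul_assoc, smul_smul]
    split_ifs <;> simp

/-- The gauge automorphism `σ_{c,a}` of `L_R(G)`: it multiplies the first edge of `c` by `a`, the
corresponding ghost edge by `a⁻¹`, and fixes all other generators. -/
noncomputable def gauge (c : G.Cyc) (a : Rˣ) : LPA R G →ₙₐ[R] LPA R G :=
  lift (gaugeFun c a) (isLeavittFamily_gaugeFun c a)

end LPA

/-! ## The Chen module of a cycle -/

section Chen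

variable {G} (c : G.Cyc)

open Classical in
/-- The action of the vertices, edges and ghost edges on the free `R`-module with basis
`[c^∞]`. -/
noncomputable def chenFun : Gen G → Module.End R (TailClass c →₀ R)
  | .vertex x => Finsupp.linearCombination R fun q =>
      if x = q.src then Finsupp.single q 1 else 0
  | .edge f => Finsupp.linearCombination R fun q =>
      if h : G.r f = q.src then Finsupp.single (q.cons f h) 1 else 0
  | .ghost f => Finsupp.linearCombination R fun q =>
      if f = q.seq 0 then Finsupp.single q.drop 1 else 0

open Classical in
lemma chenFun_vertex_single (x : G.V) (q : TailClass c) :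
    chenFun R c (.vertex x) (Finsupp.single q 1) =
      if x = q.src then Finsupp.single q 1 else 0 := by
  simp [chenFun]

open Classical in
lemma chenFun_edge_single (f : G.E) (q : TailClass c) :
    chenFun R c (.edge f) (Finsupp.single q 1) =
      if h : G.r f = q.src then Finsupp.single (q.cons f h) 1 else 0 := by
  simp [chenFun]

open Classical in
lemma chenFun_ghost_single (f : G.E) (q : TailClass c) :
    chenFun R c (.ghost f) (Finsupp.single q 1) =
      if f = q.seq 0 then Finsupp.single q.drop 1 else 0 := by
  simp [chenFun]

lemma isLeavittFamily_chenFun : IsLeavittFamily G (chenFun R c) := by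
  classical
  refine ⟨fun x => ?_, fun x y hxy => ?_, fun f => ?_, fun f => ?_, fun f => ?_,
    fun f => ?_, fun f => ?_, fun f g hfg => ?_, fun x T hT hx => ?_⟩ <;>
  refine Finsupp.lhom_ext' fun q => LinearMap.ext_ring ?_ <;>
  simp only [LinearMap.comp_apply, Finsupp.lsingle_apply, Module.End.mul_apply,
    chenFun_vertex_single, chenFun_edge_single, chenFun_ghost_single, LinearMap.zero_apply,
    LinearMap.sum_apply]
  · split_ifs with h <;> simp [chenFun_vertex_single, h]
  · split_ifs with h
    · subst h; simp [chenFun_vertex_single, hxy]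
    · simp
  · split_ifs with h
    · rw [chenFun_vertex_single, if_pos]; rfl
    · simp
  · split_ifs with h
    · simp [chenFun_edge_single, h]
    · simp
  · split_ifs with h
    · rw [chenFun_vertex_single, if_pos]; rw [q.src_drop, h]
    · simp
  · by_cases h : f = q.seq 0
    · rw [if_pos (by rw [h]; rfl), if_pos h, chenFun_ghost_single, if_pos h]
    · rw [if_neg h]
      split_ifs
      · rw [chenFun_ghost_single, if_neg h]
      · simp
  · split_ifs with h
    · rw [chenFun_ghost_single, if_pos (show f = (q.cons f h).seq 0 from rfl),
        TailClass.drop_cons]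
    · simp
  · split_ifs with h
    · rw [chenFun_ghost_single, if_neg (show f ≠ (q.cons g h).seq 0 from hfg)]
    · simp
  · by_cases h : x = q.src
    · rw [if_pos h, Finset.sum_eq_single_of_mem (q.seq 0) ((hx _).2 h.symm), if_pos rfl,
        chenFun_edge_single, dif_pos q.src_drop.symm, TailClass.cons_drop]
      intro f _ hf
      rw [if_neg hf, map_zero]
    · rw [if_neg h]
      refine Finset.sum_eq_zero fun f hf => ?_
      rw [if_neg, map_zero]
      rintro rfl
      exact h ((hx _).1 hf).symm

/-- The Chen module `V_{[c^∞]}` of `L_R(G)`: the free `R`-module with basis `[c^∞]`, with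
the vertices, edges and ghost edges acting as prescribed. -/
noncomputable def chenRep : LPA R G →ₙₐ[R] Module.End R (TailClass c →₀ R) :=
  LPA.lift (chenFun R c) (isLeavittFamily_chenFun R c)

end Chen

/-! ## Unital modules and extension spaces -/

section Unital

variable (K : Type w) [Field K]

/-- A (not necessarily unital) left module over the `K`-algebra `L_K(G)` is the same thing as a
module over its unitization. It is unital if `L_K(G) M = M`. For unital modules the
action of `K` is determined by the action of `L_K(G)`. -/
def isUnital : ObjectProperty (ModuleCat.{max u v w} (Unitization K (LPA K G))) := fun M =>
  AddSubgroup.closure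
    {m : M | ∃ (a : LPA K G) (n : M), m = (Unitization.inr a : Unitization K (LPA K G)) • n} = ⊤

variable {G K}

lemma isUnital_iff (M : ModuleCat.{max u v w} (Unitization K (LPA K G))) :
    isUnital G K M ↔ ∀ m : M, ∃ F : Finset G.V, ∀ F', F ⊆ F' →
      (Unitization.inr (LPA.unit K F') : Unitization K (LPA K G)) • m = m := by
  classical
  constructor
  · intro h m
    have hm : m ∈ (⊤ : AddSubgroup M) := trivial
    rw [← (show AddSubgroup.closure _ = ⊤ from h)] at hm
    induction hm using AddSubgroup.closure_induction with
    | mem x hx =>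
      obtain ⟨a, n, rfl⟩ := hx
      obtain ⟨F, hF⟩ := LPA.exists_unit_mul a
      exact ⟨F, fun F' h => by rw [smul_smul, ← Unitization.inr_mul, hF F' h]⟩
    | zero => exact ⟨∅, fun F' _ => smul_zero _⟩
    | add x y _ _ hx hy =>
      obtain ⟨F₁, h₁⟩ := hx
      obtain ⟨F₂, h₂⟩ := hy
      exact ⟨F₁ ∪ F₂, fun F' h => by
        rw [smul_add, h₁ F' (Finset.union_subset_left h), h₂ F' (Finset.union_subset_right h)]⟩
    | neg x _ hx =>
      obtain ⟨F₁, h₁⟩ := hx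
      exact ⟨F₁, fun F' h => by rw [smul_neg, h₁ F' h]⟩
  · intro h
    refine (AddSubgroup.eq_top_iff' _).2 fun m => AddSubgroup.subset_closure ?_
    obtain ⟨F, hF⟩ := h m
    exact ⟨_, m, (hF F subset_rfl).symm⟩

instance : (isUnital G K).IsSerreClass where
  exists_zero := ⟨.of _ PUnit, ModuleCat.isZero_of_subsingleton _,
    (isUnital_iff _).2 fun _ => ⟨∅, fun _ _ => Subsingleton.elim _ _⟩⟩
  prop_of_mono {M N} f hf hN := by
    rw [ModuleCat.mono_iff_injective] at hf
    rw [isUnital_iff] at hN ⊢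
    intro m
    obtain ⟨F, hF⟩ := hN (f.hom m)
    exact ⟨F, fun F' h => hf (by rw [map_smul]; exact hF F' h)⟩
  prop_of_epi {M N} f hf hM := by
    rw [ModuleCat.epi_iff_surjective] at hf
    rw [isUnital_iff] at hM ⊢
    intro n
    obtain ⟨m, rfl⟩ := hf n
    obtain ⟨F, hF⟩ := hM m
    exact ⟨F, fun F' h => by rw [← map_smul, hF F' h]⟩
  prop_X₂_of_shortExact {S} hS h₁ h₃ := by
    refine (AddSubgroup.eq_top_iff' _).2 fun m => ?_
    rw [isUnital_iff] at h₁ h₃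
    obtain ⟨F, hF⟩ := h₃ (S.g.hom m)
    have h0 : S.g.hom (m - (Unitization.inr (LPA.unit K F) : Unitization K (LPA K G)) • m) = 0 := by
      rw [map_sub, map_smul, hF F subset_rfl, sub_self]
    obtain ⟨n, hn⟩ := (ShortComplex.moduleCat_exact_iff S).1 hS.exact _ h0
    obtain ⟨F₁, hF₁⟩ := h₁ n
    have h1 : m = (Unitization.inr (LPA.unit K F₁) : Unitization K (LPA K G)) • S.f.hom n +
        (Unitization.inr (LPA.unit K F) : Unitization K (LPA K G)) • m := by
      rw [← map_smul, hF₁ F₁ subset_rfl]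
      exact (sub_eq_iff_eq_add.1 hn.symm)
    rw [h1]
    exact add_mem (AddSubgroup.subset_closure ⟨_, _, rfl⟩) (AddSubgroup.subset_closure ⟨_, _, rfl⟩)

instance : (isUnital G K).IsClosedUnderFiniteProducts := by
  have : (isUnital G K).IsClosedUnderBinaryProducts :=
    .mk' (by
      rintro _ ⟨F, hF⟩
      have e : F ≅ Limits.pair (F.obj ⟨.left⟩) (F.obj ⟨.right⟩) := Limits.diagramIsoPair F
      refine (isUnital G K).prop_of_iso
        ((Limits.biprod.isoProd _ _) ≪≫ (Limits.HasLimit.isoOfNatIso e).symm) ?_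
      exact ObjectProperty.prop_biprod _ (hF _) (hF _))
  exact .mk'

variable (G K)

/-- The category of unital left modules over `L_K(G)`. -/
abbrev LMod := (isUnital G K).FullSubcategory

instance : HasExt.{max (u + 1) (v + 1) (w + 1)} (LMod G K) := HasExt.standard _

end Unital

/-! ## The modules associated with a cycle and a basic irreducible polynomial -/

section Simple

variable {K : Type w} [Field K]

/-- Basic irreducible polynomials. -/
structure IsBasicIrreducible (p : K[X]) : Prop where
  irreducible : Irreducible p
  two_le_natDegree : 2 ≤ p.natDegree
  eval_zero : p.eval 0 = -1

/-- The class `x̄` of `x` in `K' = K[x]/⟨p(x)⟩`, as an invertible element; for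
`p(x) = pₙ xⁿ + ⋯ + p₁ x - 1`, its inverse is the class of `pₙ xⁿ⁻¹ + ⋯ + p₁`. -/
noncomputable def rootUnit {p : K[X]} (hp : IsBasicIrreducible p) : (AdjoinRoot p)ˣ :=
  Units.mkOfMulEqOne (AdjoinRoot.root p) (AdjoinRoot.mk p p.divX) (by
    have h := congrArg (AdjoinRoot.mk p) (Polynomial.X_mul_divX_add p)
    rw [AdjoinRoot.mk_self, map_add, map_mul, AdjoinRoot.mk_X, coeff_zero_eq_eval_zero,
      hp.eval_zero, map_neg, map_neg, map_one, map_one] at h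
    exact (add_neg_eq_zero.1 h))

variable {G} (c : G.Cyc) {p : K[X]} (hp : IsBasicIrreducible p)

/-- The Chen module of `L_{K'}(G)`, `K' = K[x]/⟨p(x)⟩`, twisted by the gauge automorphism
`σ_{c,x̄}`, and restricted to `L_K(G)`. -/
noncomputable def simpleRep :
    LPA K G →ₙₐ[K] Module.End (AdjoinRoot p) (TailClass c →₀ AdjoinRoot p) where
  toFun a := chenRep (AdjoinRoot p) c
    (LPA.gauge c (rootUnit hp) (LPA.baseChange K (AdjoinRoot p) G a))
  map_smul' k a := by
    have h : ∀ b : LPA (AdjoinRoot p) G, k • b = algebraMap K (AdjoinRoot p) k • b := by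
      intro b
      obtain ⟨b, rfl⟩ := LPA.mk_surjective b
      rw [← LPA.mk_smul, ← LPA.mk_smul, algebraMap_smul]
    simp only [map_smul, h, MonoidHom.id_apply, algebraMap_smul]
  map_zero' := by simp only [map_zero]
  map_add' a b := by simp only [map_add]
  map_mul' a b := by simp only [map_mul]

/-- The underlying space of `V^p_{[c^∞]}`: the `K'`-vector space with basis `[c^∞]`. -/
def SimpleCarrier (c : G.Cyc) {p : K[X]} (_hp : IsBasicIrreducible p) : Type (max u v w) :=
  TailClass c →₀ AdjoinRoot p

noncomputable instance : AddCommGroup (SimpleCarrier c hp) :=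
  inferInstanceAs (AddCommGroup (TailClass c →₀ AdjoinRoot p))

noncomputable instance : Module (Unitization K (LPA K G)) (SimpleCarrier c hp) :=
  letI : Module (Module.End (AdjoinRoot p) (TailClass c →₀ AdjoinRoot p)) (SimpleCarrier c hp) :=
    inferInstanceAs (Module (Module.End (AdjoinRoot p) (TailClass c →₀ AdjoinRoot p))
      (TailClass c →₀ AdjoinRoot p))
  Module.compHom (SimpleCarrier c hp) (Unitization.lift (simpleRep c hp)).toRingHom

lemma inr_smul (a : LPA K G) (m : SimpleCarrier c hp) :
    (Unitization.inr a : Unitization K (LPA K G)) • m = simpleRep c hp a m := by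
  change (Unitization.lift (simpleRep c hp) (Unitization.inr a)) m = _
  have h := Unitization.lift_symm_apply_apply (Unitization.lift (simpleRep c hp)) a
  rw [Equiv.symm_apply_apply] at h
  rw [h]

lemma isUnital_simple : isUnital G K (.of _ (SimpleCarrier c hp)) := by
  refine (AddSubgroup.eq_top_iff' _).2 fun m => ?_
  induction m using Finsupp.induction_linear with
  | zero => exact zero_mem _
  | add a b ha hb => exact add_mem ha hb
  | single q k =>
    refine AddSubgroup.subset_closure
      ⟨LPA.gen K (.vertex q.src), Finsupp.single q k, (Eq.trans (inr_smul c hp _ _) ?_).symm⟩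
    simp only [simpleRep, NonUnitalAlgHom.coe_mk, LPA.baseChange, LPA.lift_gen, LPA.gauge,
      LPA.gaugeFun, chenRep]
    simp [chenFun]
    rfl

/-- The `L_K(G)`-module `V^p_{[c^∞]}`, as an object of the category of unital modules. -/
noncomputable def simpleModule : LMod G K := ⟨.of _ (SimpleCarrier c hp), isUnital_simple c hp⟩

end Simple

end DirGraph

/-!
Write `V = V^p_{[c^∞]}`, `M = V^q_{[e^∞]}`, `L = L_K(G)`, and `c₀` for the first edge of `c`.
Heuristically `V` is `L v / L p(c)` with `v = s(c)`, so that `Ext¹(V, M)` is the cokernel of `p(c)`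
on `v M`, and this cokernel is large as soon as many infinite paths of the class `[e^∞]` start at
`v` without starting with `c`. The proof makes this precise without a projective resolution of `V`.

*Extensions.* Multiplying each edge of a representation on the right by a unit that commutes with
the range of the edge, and its ghost edge on the left by the inverse, gives a representation again
(`IsLeavittFamily.twist`). Twisting the edge `c₀` of `L ⊕ V` by a shear
`(a, z) ↦ (a + θ z, z)` gives an extension `0 → L → P → V → 0` (`extRep`, `extComplex_shortExact`).
Composing its class with the maps `L → M`, `a ↦ a m`, gives a `K`-linear map `M → Ext¹(V, M)`
(`connecting`). It vanishes on `m` only if `a ↦ a m` extends to `P`. In `V` the element `c^∞` is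
killed by `p(c)`; if `θ` is built from the linear form on `K[x]/⟨p⟩` that reads off the highest
coefficient, then carrying this relation over to `M` along the extended map shows that `c₀ m` lies
in the image of `p(c)` on `M` (`exists_aeval_eq_of_cycleClass_eq_zero`).

*Independence.* Let `x` be an infinite path from `v` that does not start with `c`. The paths
`x, c x, c² x, …` are distinct, and the coefficients at these paths turn the action of `c` into the
multiplication by `X` on a polynomial ring (`orbitPoly`). As `deg p ≥ 2`, comparing degrees shows
that no nonzero combination of the paths `c x`, for varying `x`, lies in the image of `p(c)`
(`eq_zero_of_aeval_eq`). Every such combination has the form `c₀ m`, so the space with basis the set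
of all `x` embeds in `Ext¹(V, M)` (`deviatingClass_injective`).

*Combinatorics.* There are infinitely many such `x` (`infinite_deviating`). If `c` is not exclusive,
it has an exit from which one can return to `c`; if `c` is exclusive and `e` is not, every path from
`c` to `e` leaves `c`, and `e` has an exit with a return. A cycle with an exit with a return carries
two injective self-maps with disjoint ranges on the set of the paths of `[e^∞]` that start at its
base, so this set is infinite unless it is empty (`Cyc.IsExit.infinite_of_return`).
-/

namespace DirGraph

/-! ### Cycles and exits -/

section Combinatorics

variable {G : DirGraph.{u, v}}

namespace Cyc

variable (c : G.Cyc)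

lemma inf_mod (i : ℕ) : c.inf (i % c.edges.length) = c.inf i := by
  simp [inf]

lemma inf_add_length (i : ℕ) : c.inf (i + c.edges.length) = c.inf i := by
  simp [inf]

lemma inf_zero : c.inf 0 = c.first := by
  simp [inf, first, List.head_eq_getElem]

lemma inf_length : c.inf c.edges.length = c.first := by
  rw [← c.inf_zero, ← c.inf_add_length 0, zero_add]

lemma inf_of_lt {i : ℕ} (hi : i < c.edges.length) : c.inf i = c.edges[i] := by
  simp [inf, Nat.mod_eq_of_lt hi]

lemma exists_inf_eq {f : G.E} (hf : f ∈ c.edges) : ∃ i, c.inf i = f := by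
  obtain ⟨i, hi, rfl⟩ := List.mem_iff_getElem.1 hf
  exact ⟨i, c.inf_of_lt hi⟩

lemma inf_mem (i : ℕ) : c.inf i ∈ c.edges := List.getElem_mem _

lemma chain_inf (i : ℕ) : G.r (c.inf i) = G.s (c.inf (i + 1)) := by
  have hn := c.length_pos
  have hlt := Nat.mod_lt i hn
  have key : ∀ k < c.edges.length, G.r (c.inf k) = G.s (c.inf (k + 1)) := by
    intro k hk
    rcases Nat.lt_or_ge (k + 1) c.edges.length with h | h
    · rw [c.inf_of_lt hk, c.inf_of_lt h]
      exact List.isChain_iff_getElem.1 c.chain k h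
    · have h1 : k + 1 = c.edges.length := by omega
      rw [h1, c.inf_length, c.inf_of_lt hk, first, ← c.closed, List.getLast_eq_getElem]
      congr 2
      omega
  rw [← c.inf_mod i, key _ hlt, ← c.inf_mod (i + 1), ← c.inf_mod (i % c.edges.length + 1)]
  congr 2
  simp [Nat.add_mod]

lemma mod_eq_of_source_eq {i j : ℕ} (h : G.s (c.inf i) = G.s (c.inf j)) :
    i % c.edges.length = j % c.edges.length := by
  have hi : i % c.edges.length < (c.edges.map G.s).length := by
    simpa using Nat.mod_lt i c.length_pos
  have hj : j % c.edges.length < (c.edges.map G.s).length := by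
    simpa using Nat.mod_lt j c.length_pos
  refine (c.nodup.getElem_inj_iff (hi := hi) (hj := hj)).1 ?_
  simpa [inf] using h

lemma inf_ne_first {i : ℕ} (h0 : 0 < i) (hi : i < c.edges.length) : c.inf i ≠ c.first := by
  rw [← c.inf_zero]
  intro h
  have := c.mod_eq_of_source_eq (congrArg G.s h)
  rw [Nat.mod_eq_of_lt hi, Nat.zero_mod] at this
  omega

lemma reaches_add (i k : ℕ) : G.Reaches (G.s (c.inf i)) (G.s (c.inf (i + k))) := by
  induction k with
  | zero => exact .refl
  | succ k ih => exact ih.tail ⟨_, rfl, c.chain_inf _⟩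

lemma inf_add_mul_length (i k : ℕ) : c.inf (i + k * c.edges.length) = c.inf i := by
  simp [inf]

/-- Any two vertices of a cycle are connected by a path. -/
lemma reaches_source (i j : ℕ) : G.Reaches (G.s (c.inf i)) (G.s (c.inf j)) := by
  have hn := c.length_pos
  have h := c.reaches_add i (j + i * c.edges.length - i)
  have hle : i ≤ i * c.edges.length := Nat.le_mul_of_pos_right i hn
  rwa [show i + (j + i * c.edges.length - i) = j + i * c.edges.length by omega,
    c.inf_add_mul_length] at h

lemma isRotated_of_inf_eq {c d : G.Cyc} {i j : ℕ} (h : ∀ k, d.inf (j + k) = c.inf (i + k)) :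
    d.edges ~r c.edges := by
  have hdvd : ∀ {c d : G.Cyc} {i j : ℕ}, (∀ k, d.inf (j + k) = c.inf (i + k)) →
      c.edges.length ∣ d.edges.length := by
    intro c d i j h
    have h1 := h d.edges.length
    rw [d.inf_add_length, ← Nat.add_zero j, h 0] at h1
    exact (Nat.ModEq.add_left_cancel' i (c.mod_eq_of_source_eq (congrArg G.s h1).symm)).dvd_iff
      dvd_rfl |>.2 (dvd_zero _)
  have hlen : d.edges.length = c.edges.length :=
    Nat.dvd_antisymm (hdvd fun k => (h k).symm) (hdvd h)
  have hrot : d.edges.rotate j = c.edges.rotate i := by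
    refine List.ext_getElem (by simpa using hlen) fun k h1 h2 => ?_
    rw [List.getElem_rotate, List.getElem_rotate]
    have := h k
    rw [Nat.add_comm j, Nat.add_comm i] at this
    exact this
  exact (List.IsRotated.forall _ j).symm.trans (hrot ▸ List.IsRotated.forall _ i)

/-- `c.IsExit x f i` says that the edge `f` leaves the cycle `c` at the source of its `i`-th edge,
and that a path leads from the range of `f` to the vertex `x`. -/
structure IsExit (x : G.V) (f : G.E) (i : ℕ) : Prop where
  lt_length : i < c.edges.length
  source_eq : G.s f = G.s (c.inf i)
  ne : f ≠ c.inf i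
  reaches : G.Reaches (G.r f) x

lemma eq_inf_of_forall_not_isExit {x : G.V} (h : ∀ f i, ¬ c.IsExit x f i) {f : G.E} {i : ℕ}
    (hf : G.s f = G.s (c.inf i)) (hx : G.Reaches (G.r f) x) : f = c.inf i := by
  by_contra hne
  refine h f (i % c.edges.length) ⟨Nat.mod_lt _ c.length_pos, ?_, ?_, hx⟩ <;>
  rwa [c.inf_mod]

/-- A cycle meeting `c` that never leaves `c` is a rotation of `c`. So if `c` is not exclusive,
it has an exit from which one can return. -/
lemma exists_isExit_of_not_isExclusive (hc : ¬ c.IsExclusive) : ∃ f i, c.IsExit c.base f i := by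
  by_contra! hex
  refine hc fun d ⟨f, hf, g, hg, hfg⟩ => ?_
  obtain ⟨i, rfl⟩ := c.exists_inf_eq hf
  obtain ⟨j, rfl⟩ := d.exists_inf_eq hg
  have hret : ∀ k, G.Reaches (G.r (d.inf k)) c.base := by
    intro k
    rw [d.chain_inf, base, ← c.inf_zero]
    exact (d.reaches_source _ j).trans (hfg ▸ c.reaches_source i 0)
  have hs : ∀ k, G.s (d.inf (j + k)) = G.s (c.inf (i + k)) := by
    intro k
    induction k with
    | zero => exact hfg.symm
    | succ k ih =>
      rw [← Nat.add_assoc, ← Nat.add_assoc, ← d.chain_inf, ← c.chain_inf,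
        c.eq_inf_of_forall_not_isExit hex ih (hret _)]
  exact isRotated_of_inf_eq fun k => c.eq_inf_of_forall_not_isExit hex (hs k) (hret _)

lemma IsExclusive.of_isRotated {c e : G.Cyc} (hc : c.IsExclusive) (h : e.edges ~r c.edges) :
    e.IsExclusive := by
  rintro d ⟨f, hf, g, hg, hfg⟩
  exact (hc d ⟨f, h.mem_iff.1 hf, g, hg, hfg⟩).trans h.symm

/-- If an exclusive cycle `c` is connected to a non-exclusive cycle `e`, then `e` does not meet
`c`, so that a path from `c` to `e` has to leave `c`. -/
lemma IsExclusive.exists_isExit {c e : G.Cyc} (hc : c.IsExclusive) (he : ¬ e.IsExclusive)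
    (hpath : G.Reaches c.base e.base) : ∃ f i, c.IsExit e.base f i := by
  by_contra! hex
  have key : ∀ x, G.Reaches x e.base → (∃ i, x = G.s (c.inf i)) →
      ∃ i, e.base = G.s (c.inf i) := by
    intro x hx
    induction hx using Relation.ReflTransGen.head_induction_on with
    | refl => exact id
    | head h h' ih =>
      rintro ⟨i, rfl⟩
      obtain ⟨f, hf, rfl⟩ := h
      exact ih ⟨i + 1, by rw [c.eq_inf_of_forall_not_isExit hex hf h', c.chain_inf]⟩
  obtain ⟨i, hi⟩ := key _ hpath ⟨0, by rw [c.inf_zero, base]⟩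
  exact he (hc.of_isRotated (hc e ⟨_, c.inf_mem i, _, List.head_mem e.ne_nil, hi.symm⟩))

end Cyc

/-! ### Infinitely many infinite paths -/

namespace TailClass

variable {e : G.Cyc}

/-- The infinite path `eᵢ eᵢ₊₁ ⋯`, obtained from `e^∞` by removing the first `i` edges. -/
def infFrom (e : G.Cyc) (i : ℕ) : TailClass e where
  seq n := e.inf (i + n)
  chain n := e.chain_inf (i + n)
  tail := by
    have hle : i ≤ i * e.edges.length := Nat.le_mul_of_pos_right i e.length_pos
    refine ⟨i * e.edges.length - i, fun k => ?_⟩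
    rw [← e.inf_add_mul_length k i]
    congr 1
    omega

lemma src_infFrom_zero : (infFrom e 0).src = e.base := congrArg G.s e.inf_zero

lemma cons_infFrom (i : ℕ) : (infFrom e (i + 1)).cons (e.inf i) (e.chain_inf i) = infFrom e i := by
  ext n
  cases n with
  | zero => rfl
  | succ n => exact congrArg e.inf (by omega)

lemma infFrom_length : infFrom e e.edges.length = infFrom e 0 := by
  ext n
  change e.inf (e.edges.length + n) = e.inf (0 + n)
  rw [Nat.add_comm, e.inf_add_length, Nat.zero_add]

lemma cons_injective (f : G.E) :
    Function.Injective fun q : {q : TailClass e // q.src = G.r f} => q.1.cons f q.2.symm :=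
  fun _ _ hq => Subtype.ext (congrArg drop hq)

/-- The infinite path `c₀ c₁ ⋯ c_{i-1} q`, whose first `i` edges are those of `c^∞`. -/
def splice (c : G.Cyc) (i : ℕ) (q : TailClass e) (h : q.src = G.s (c.inf i)) : TailClass e where
  seq n := if n < i then c.inf n else q.seq (n - i)
  chain n := by
    split_ifs with h1 h2 h2
    · exact c.chain_inf n
    · obtain rfl : i = n + 1 := by omega
      rw [Nat.sub_self, c.chain_inf, ← h, src]
    · omega
    · rw [q.chain, Nat.sub_add_comm (by omega)]
  tail := by
    obtain ⟨m, hm⟩ := q.tail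
    refine ⟨i + m, fun k => ?_⟩
    rw [if_neg (by omega), ← hm]
    congr 1
    omega

variable {c : G.Cyc}

lemma splice_zero {q : TailClass e} (h : q.src = G.s (c.inf 0)) : q.splice c 0 h = q := by
  ext n
  simp [splice]

lemma splice_succ {i : ℕ} {q : TailClass e} (h : q.src = G.s (c.inf (i + 1))) :
    q.splice c (i + 1) h = (q.cons (c.inf i) ((c.chain_inf i).trans h.symm)).splice c i rfl := by
  ext n
  simp only [splice, cons]
  rcases lt_trichotomy n i with h1 | rfl | h1
  · rw [if_pos (by omega), if_pos h1]
  · simp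
  · rw [if_neg (by omega), if_neg (by omega)]
    obtain ⟨k, rfl⟩ := Nat.exists_eq_add_of_lt h1
    rw [show i + k + 1 - (i + 1) = k by omega, show i + k + 1 - i = k + 1 by omega]

lemma splice_seq_of_lt {i n : ℕ} {q : TailClass e} (h : q.src = G.s (c.inf i)) (hn : n < i) :
    (q.splice c i h).seq n = c.inf n := if_pos hn

lemma splice_seq_self {i : ℕ} {q : TailClass e} (h : q.src = G.s (c.inf i)) :
    (q.splice c i h).seq i = q.seq 0 := by simp [splice]

lemma src_splice {i : ℕ} {q : TailClass e} (h : q.src = G.s (c.inf i)) :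
    (q.splice c i h).src = c.base := by
  rw [Cyc.base, ← c.inf_zero]
  rcases Nat.eq_zero_or_pos i with rfl | hi
  · rw [splice_zero, h]
  · rw [src, splice_seq_of_lt h hi]

lemma splice_injective (c : G.Cyc) (i : ℕ) :
    Function.Injective fun q : {q : TailClass e // q.src = G.s (c.inf i)} =>
      q.1.splice c i q.2 := by
  intro q q' hq
  ext n
  simpa [splice] using congrFun (congrArg seq hq) (n + i)

/-- Prepending the cycle `c` to the infinite paths that start at its base. -/
def around (c : G.Cyc) (q : {q : TailClass e // q.src = c.base}) :
    {q : TailClass e // q.src = c.base} :=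
  ⟨q.1.splice c c.edges.length (q.2.trans (congrArg G.s c.inf_length.symm)), src_splice _⟩

lemma around_injective (c : G.Cyc) : Function.Injective (around (e := e) c) := by
  intro q q' hq
  have h : c.base = G.s (c.inf c.edges.length) := congrArg G.s c.inf_length.symm
  exact Subtype.ext (Subtype.mk.inj (splice_injective c _ (a₁ := ⟨q.1, q.2.trans h⟩)
    (a₂ := ⟨q'.1, q'.2.trans h⟩) (Subtype.ext_iff.1 hq)))

lemma around_seq (q : {q : TailClass e // q.src = c.base}) {i : ℕ} (hi : i < c.edges.length) :
    (around c q).1.seq i = c.inf i := if_pos hi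

end TailClass

lemma Reaches.exists_injective {a b : G.V} (h : G.Reaches a b) (e : G.Cyc) :
    ∃ φ : {q : TailClass e // q.src = b} → {q : TailClass e // q.src = a},
      Function.Injective φ := by
  induction h using Relation.ReflTransGen.head_induction_on with
  | refl => exact ⟨id, Function.injective_id⟩
  | head h _ ih =>
    obtain ⟨f, rfl, rfl⟩ := h
    obtain ⟨φ, hφ⟩ := ih
    exact ⟨fun q => ⟨(φ q).1.cons f (φ q).2.symm, rfl⟩,
      fun _ _ h => hφ (TailClass.cons_injective f (Subtype.ext_iff.1 h))⟩

/-- Prepending the edges of a cycle up to an exit, and then the exit. -/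
lemma Cyc.IsExit.exists_injective {c : G.Cyc} {x : G.V} {f : G.E} {i : ℕ} (h : c.IsExit x f i)
    (e : G.Cyc) :
    ∃ φ : {q : TailClass e // q.src = G.r f} → {q : TailClass e // q.src = c.base},
      Function.Injective φ ∧ ∀ q, (φ q).1.seq i ≠ c.inf i :=
  ⟨fun q => ⟨(q.1.cons f q.2.symm).splice c i h.source_eq, TailClass.src_splice _⟩,
    fun q q' hq => TailClass.cons_injective f (Subtype.ext_iff.1
      (TailClass.splice_injective c i (a₁ := ⟨q.1.cons f q.2.symm, h.source_eq⟩)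
        (a₂ := ⟨q'.1.cons f q'.2.symm, h.source_eq⟩) (Subtype.ext_iff.1 hq))),
    fun q => (TailClass.splice_seq_self (q := q.1.cons f q.2.symm) h.source_eq).trans_ne h.ne⟩

/-- Let `c` have an exit with a return, and let `S` be the set of the paths of the class `[e^∞]`
that start at the base of `c`. Going once around `c`, and going around via the exit, are two
injective maps from `S` to `S` with disjoint ranges. Hence `S` is infinite or empty. -/
lemma Cyc.IsExit.infinite_of_return {c e : G.Cyc} {f : G.E} {i : ℕ} (h : c.IsExit c.base f i)
    (q : TailClass e) (hq : q.src = c.base) : Infinite {q : TailClass e // q.src = c.base} := by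
  by_contra hfin
  rw [not_infinite_iff_finite] at hfin
  obtain ⟨φ, -, hφ⟩ := h.exists_injective e
  obtain ⟨ψ, -⟩ := h.reaches.exists_injective e
  obtain ⟨q', hq'⟩ := Finite.surjective_of_injective (TailClass.around_injective c) (φ (ψ ⟨q, hq⟩))
  apply hφ (ψ ⟨q, hq⟩)
  rw [← hq']
  exact TailClass.around_seq q' h.lt_length

/-- If `c` and `e` are not both exclusive, infinitely many paths of the class `[e^∞]` start at the
base of `c` and do not start with `c`. -/
lemma infinite_deviating {c e : G.Cyc} (hpath : G.Reaches c.base e.base)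
    (hce : ¬ (c.IsExclusive ∧ e.IsExclusive)) :
    Infinite {q : TailClass e // q.src = c.base ∧ ∃ i < c.edges.length, q.seq i ≠ c.inf i} := by
  suffices ∃ x f i, c.IsExit x f i ∧ Infinite {q : TailClass e // q.src = G.r f} by
    obtain ⟨x, f, i, hf, hinf⟩ := this
    obtain ⟨φ, hφ, hdev⟩ := hf.exists_injective e
    exact Infinite.of_injective (fun q => ⟨(φ q).1, (φ q).2, i, hf.lt_length, hdev q⟩)
      fun q q' h => hφ (Subtype.ext (Subtype.ext_iff.1 h :))
  by_cases hc : c.IsExclusive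
  · have he : ¬ e.IsExclusive := fun he => hce ⟨hc, he⟩
    obtain ⟨f, i, hf⟩ := hc.exists_isExit he hpath
    obtain ⟨g, j, hg⟩ := e.exists_isExit_of_not_isExclusive he
    have := hg.infinite_of_return (TailClass.infFrom e 0) TailClass.src_infFrom_zero
    obtain ⟨φ, hφ⟩ := hf.reaches.exists_injective e
    exact ⟨_, f, i, hf, Infinite.of_injective φ hφ⟩
  · obtain ⟨f, i, hf⟩ := c.exists_isExit_of_not_isExclusive hc
    obtain ⟨φ, hφ⟩ := hpath.exists_injective e
    have := hf.infinite_of_return (φ ⟨TailClass.infFrom e 0, TailClass.src_infFrom_zero⟩).1 (φ _).2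
    obtain ⟨ψ, hψ⟩ := hf.reaches.exists_injective e
    exact ⟨_, f, i, hf, Infinite.of_injective ψ hψ⟩

end Combinatorics

/-! ### Twisting a representation, and extensions of representations -/

section Twist

variable {G : DirGraph.{u, v}}

lemma IsLeavittFamily.of_hom {R : Type w} [CommRing R] {A : Type t} [NonUnitalRing A] [Module R A]
    (ψ : LPA R G →ₙₐ[R] A) : IsLeavittFamily G fun x => ψ (LPA.gen R x) := by
  have h := LPA.isLeavittFamily_gen (R := R) (G := G)
  refine ⟨fun x => ?_, fun x y hxy => ?_, fun f => ?_, fun f => ?_, fun f => ?_,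
    fun f => ?_, fun f => ?_, fun f g hfg => ?_, fun x T hT hx => ?_⟩
  · rw [← map_mul, h.vertex_mul_self]
  · rw [← map_mul, h.vertex_mul_of_ne x y hxy, map_zero]
  · rw [← map_mul, h.source_mul_edge]
  · rw [← map_mul, h.edge_mul_range]
  · rw [← map_mul, h.range_mul_ghost]
  · rw [← map_mul, h.ghost_mul_source]
  · rw [← map_mul, h.ghost_mul_edge_self]
  · rw [← map_mul, h.ghost_mul_edge_of_ne f g hfg, map_zero]
  · simp_rw [← map_mul]
    rw [← map_sum, h.sum_edge_mul_ghost x T hT hx]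

/-- The family obtained by multiplying every edge `f` by a unit `u f` on the right, and its ghost
edge by the inverse of `u f` on the left. -/
def twistFun {A : Type t} [Ring A] (φ : Gen G → A) (u : G.E → Aˣ) : Gen G → A
  | .vertex x => φ (.vertex x)
  | .edge f => φ (.edge f) * u f
  | .ghost f => ((u f)⁻¹ : Aˣ) * φ (.ghost f)

lemma IsLeavittFamily.twist {A : Type t} [Ring A] {φ : Gen G → A} (h : IsLeavittFamily G φ)
    {u : G.E → Aˣ} (hu : ∀ f, Commute (u f : A) (φ (.vertex (G.r f)))) :
    IsLeavittFamily G (twistFun φ u) := by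
  refine ⟨h.vertex_mul_self, h.vertex_mul_of_ne, fun f => ?_, fun f => ?_, fun f => ?_,
    fun f => ?_, fun f => ?_, fun f g hfg => ?_, fun x T hT hx => ?_⟩ <;> simp only [twistFun]
  · rw [← mul_assoc, h.source_mul_edge]
  · rw [mul_assoc, (hu f).eq, ← mul_assoc, h.edge_mul_range]
  · rw [← mul_assoc, ← (hu f).units_inv_left.eq, mul_assoc, h.range_mul_ghost]
  · rw [mul_assoc, h.ghost_mul_source]
  · rw [mul_assoc, ← mul_assoc (φ _), h.ghost_mul_edge_self, ← (hu f).eq, Units.inv_mul_cancel_left]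
  · rw [mul_assoc, ← mul_assoc (φ _), h.ghost_mul_edge_of_ne f g hfg, zero_mul, mul_zero]
  · rw [← h.sum_edge_mul_ghost x T hT hx]
    exact Finset.sum_congr rfl fun f _ => by rw [mul_assoc, Units.mul_inv_cancel_left]

variable {K : Type w} [Field K] {U V : Type*} [AddCommGroup U] [Module K U] [AddCommGroup V]
  [Module K V]

/-- The unipotent automorphism `(y, z) ↦ (y + θ z, z)`. -/
def shear (θ : V →ₗ[K] U) : (Module.End K (U × V))ˣ where
  val := (LinearMap.fst K U V + θ ∘ₗ LinearMap.snd K U V).prod (LinearMap.snd K U V)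
  inv := (LinearMap.fst K U V - θ ∘ₗ LinearMap.snd K U V).prod (LinearMap.snd K U V)
  val_inv := by ext <;> simp
  inv_val := by ext <;> simp

/-- The direct sum of two representations. -/
noncomputable def sumRep (σ : LPA K G →ₙₐ[K] Module.End K U) (ρ : LPA K G →ₙₐ[K] Module.End K V) :
    LPA K G →ₙₐ[K] Module.End K (U × V) :=
  ((LinearMap.prodMapAlgHom K U V : _ →ₐ[K] _) : _ →ₙₐ[K] _).comp (σ.prod ρ)

variable (σ : LPA K G →ₙₐ[K] Module.End K U) (ρ : LPA K G →ₙₐ[K] Module.End K V)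

lemma sumRep_apply (a : LPA K G) (y : U × V) : sumRep σ ρ a y = (σ a y.1, ρ a y.2) := rfl

variable (θ : G.E → V →ₗ[K] U)
  (hθ : ∀ f z, θ f (ρ (LPA.gen K (.vertex (G.r f))) z) = σ (LPA.gen K (.vertex (G.r f))) (θ f z))

/-- An extension of the representation `ρ` by the representation `σ`: the direct sum of the two,
in which every edge `f` is twisted by the shear of a linear map `θ f`. -/
noncomputable def extRep : LPA K G →ₙₐ[K] Module.End K (U × V) :=
  LPA.lift (twistFun (fun x => sumRep σ ρ (LPA.gen K x)) fun f => shear (θ f))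
    ((IsLeavittFamily.of_hom (sumRep σ ρ)).twist fun f => LinearMap.ext fun y => by
      simp [Module.End.mul_apply, sumRep_apply, shear, hθ])

lemma extRep_vertex (x : G.V) (y : U × V) :
    extRep σ ρ θ hθ (LPA.gen K (.vertex x)) y =
      (σ (LPA.gen K (.vertex x)) y.1, ρ (LPA.gen K (.vertex x)) y.2) := by
  rw [extRep, LPA.lift_gen]
  rfl

lemma extRep_edge (f : G.E) (y : U × V) :
    extRep σ ρ θ hθ (LPA.gen K (.edge f)) y =
      (σ (LPA.gen K (.edge f)) (y.1 + θ f y.2), ρ (LPA.gen K (.edge f)) y.2) := by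
  rw [extRep, LPA.lift_gen]
  rfl

lemma extRep_ghost (f : G.E) (y : U × V) :
    extRep σ ρ θ hθ (LPA.gen K (.ghost f)) y =
      (σ (LPA.gen K (.ghost f)) y.1 - θ f (ρ (LPA.gen K (.ghost f)) y.2),
        ρ (LPA.gen K (.ghost f)) y.2) := by
  rw [extRep, LPA.lift_gen]
  rfl

lemma extRep_inl (a : LPA K G) (y : U) : extRep σ ρ θ hθ a (y, 0) = (σ a y, 0) := by
  induction a using LPA.induction generalizing y with
  | hgen x => cases x <;> simp [extRep_vertex, extRep_edge, extRep_ghost]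
  | hsmul k a h => simp [h]
  | hadd a b ha hb => simp [ha, hb]
  | hmul a b ha hb => simp [Module.End.mul_apply, ha, hb]
  | hzero => simp [Prod.zero_eq_mk]

lemma extRep_snd (a : LPA K G) (y : U × V) : (extRep σ ρ θ hθ a y).2 = ρ a y.2 := by
  induction a using LPA.induction generalizing y with
  | hgen x => cases x <;> simp [extRep_vertex, extRep_edge, extRep_ghost]
  | hsmul k a h => simp [h]
  | hadd a b ha hb => simp [ha, hb]
  | hmul a b ha hb => simp [Module.End.mul_apply, ha, hb]
  | hzero => simp

lemma extRep_unit (F : Finset G.V) (y : U × V) :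
    extRep σ ρ θ hθ (LPA.unit K F) y = (σ (LPA.unit K F) y.1, ρ (LPA.unit K F) y.2) := by
  simp only [LPA.unit, map_sum, LinearMap.sum_apply, extRep_vertex]
  ext <;> simp [Prod.fst_sum, Prod.snd_sum]

end Twist

/-! ### Representations as unital modules -/

section RepModule

variable {G : DirGraph.{u, v}} {K : Type w} [Field K] {W : Type t} [AddCommGroup W] [Module K W]

/-- The space of a representation of `L_K(G)`, as a module over the unitization. -/
def RepModule (_ρ : LPA K G →ₙₐ[K] Module.End K W) : Type t := W

variable (ρ : LPA K G →ₙₐ[K] Module.End K W)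

instance : AddCommGroup (RepModule ρ) := inferInstanceAs (AddCommGroup W)

noncomputable instance : Module (Unitization K (LPA K G)) (RepModule ρ) :=
  letI : Module (Module.End K W) (RepModule ρ) := inferInstanceAs (Module (Module.End K W) W)
  Module.compHom (RepModule ρ) (Unitization.lift ρ).toRingHom

/-- The identification of a representation space with the module. -/
def RepModule.of : W ≃+ RepModule ρ := AddEquiv.refl W

lemma RepModule.smul_of (z : Unitization K (LPA K G)) (m : W) :
    z • RepModule.of ρ m = RepModule.of ρ (z.fst • m + ρ z.snd m) := by
  change Unitization.lift ρ z m = _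
  rw [Unitization.lift_apply]
  rfl

lemma RepModule.inr_smul_of (a : LPA K G) (m : W) :
    (Unitization.inr a : Unitization K (LPA K G)) • RepModule.of ρ m = RepModule.of ρ (ρ a m) := by
  simp [RepModule.smul_of]

lemma RepModule.inl_smul_of (k : K) (m : W) :
    (Unitization.inl k : Unitization K (LPA K G)) • RepModule.of ρ m = RepModule.of ρ (k • m) := by
  simp [RepModule.smul_of]

lemma RepModule.isUnital {W : Type (max u v w)} [AddCommGroup W] [Module K W]
    (ρ : LPA K G →ₙₐ[K] Module.End K W)
    (h : ∀ m, ∃ F : Finset G.V, ∀ F', F ⊆ F' → ρ (LPA.unit K F') m = m) :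
    isUnital G K (.of _ (RepModule ρ)) := by
  rw [isUnital_iff]
  intro m
  obtain ⟨F, hF⟩ := h m
  exact ⟨F, fun F' hF' => (RepModule.inr_smul_of ρ _ _).trans (congrArg _ (hF F' hF'))⟩

/-- The left regular representation of `L_K(G)`. -/
noncomputable abbrev regularRep (G : DirGraph.{u, v}) (K : Type w) [Field K] :
    LPA K G →ₙₐ[K] Module.End K (LPA K G) := NonUnitalAlgHom.lmul K (LPA K G)

variable (c : G.Cyc) {p : K[X]} (hp : IsBasicIrreducible p)

/-- The representation on `V^p_{[c^∞]}`, by `K`-linear maps. -/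
noncomputable def simpleRepK :
    LPA K G →ₙₐ[K] Module.End K (TailClass c →₀ AdjoinRoot p) where
  toFun a := (simpleRep c hp a).restrictScalars K
  map_smul' k a := by ext1 x; simp
  map_zero' := by ext1 x; simp
  map_add' a b := by ext1 x; simp
  map_mul' a b := by rw [map_mul]; rfl

lemma simpleRepK_apply (a : LPA K G) (m : TailClass c →₀ AdjoinRoot p) :
    simpleRepK c hp a m = simpleRep c hp a m := rfl

/-- The identification of the `K'`-vector space with basis `[c^∞]` with `V^p_{[c^∞]}`. -/
noncomputable def SimpleCarrier.of : (TailClass c →₀ AdjoinRoot p) ≃+ SimpleCarrier c hp := AddEquiv.refl _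

lemma SimpleCarrier.smul_of (z : Unitization K (LPA K G)) (m : TailClass c →₀ AdjoinRoot p) :
    z • SimpleCarrier.of c hp m = SimpleCarrier.of c hp (z.fst • m + simpleRep c hp z.snd m) := by
  change Unitization.lift (simpleRep c hp) z m = _
  rw [Unitization.lift_apply]
  rfl

lemma SimpleCarrier.inr_smul_of (a : LPA K G) (m : TailClass c →₀ AdjoinRoot p) :
    (Unitization.inr a : Unitization K (LPA K G)) • SimpleCarrier.of c hp m =
      SimpleCarrier.of c hp (simpleRep c hp a m) := by
  simp [SimpleCarrier.smul_of]

lemma SimpleCarrier.inl_smul_of (k : K) (m : TailClass c →₀ AdjoinRoot p) :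
    (Unitization.inl k : Unitization K (LPA K G)) • SimpleCarrier.of c hp m =
      SimpleCarrier.of c hp (k • m) := by
  simp [SimpleCarrier.smul_of]

lemma simpleRep_unit (m : TailClass c →₀ AdjoinRoot p) :
    ∃ F : Finset G.V, ∀ F', F ⊆ F' → simpleRep c hp (LPA.unit K F') m = m := by
  obtain ⟨F, hF⟩ := (isUnital_iff _).1 (isUnital_simple c hp) m
  exact ⟨F, fun F' h => (inr_smul c hp _ _).symm.trans (hF F' h)⟩

end RepModule

/-! ### The connecting homomorphism of an extension by the regular module -/

section Connecting

variable {G : DirGraph.{u, v}} {K : Type w} [Field K]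

variable (G K) in
/-- `L_K(G)` as a unital left module over itself. -/
noncomputable def regularModule : LMod G K :=
  ⟨.of _ (RepModule (regularRep G K)), RepModule.isUnital _ LPA.exists_unit_mul⟩

variable (c : G.Cyc) {p : K[X]} (hp : IsBasicIrreducible p)
  (θ : G.E → (TailClass c →₀ AdjoinRoot p) →ₗ[K] LPA K G)
  (hθ : ∀ f z, θ f (simpleRepK c hp (LPA.gen K (.vertex (G.r f))) z) =
    regularRep G K (LPA.gen K (.vertex (G.r f))) (θ f z))

/-- The space of the extension of `V^p_{[c^∞]}` by `L_K(G)` given by `θ`. -/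
abbrev ExtCarrier : Type (max u v w) := RepModule (extRep (regularRep G K) (simpleRepK c hp) θ hθ)

/-- The extension of `V^p_{[c^∞]}` by `L_K(G)` given by `θ`. -/
noncomputable def extModule : LMod G K :=
  ⟨.of _ (ExtCarrier c hp θ hθ), RepModule.isUnital _ fun m => by
    classical
    obtain ⟨F₁, h₁⟩ := LPA.exists_unit_mul m.1
    obtain ⟨F₂, h₂⟩ := simpleRep_unit c hp m.2
    refine ⟨F₁ ∪ F₂, fun F' h => ?_⟩
    rw [extRep_unit]
    exact Prod.ext (h₁ F' (Finset.union_subset_left h)) (h₂ F' (Finset.union_subset_right h))⟩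

/-- The inclusion of `L_K(G)` in the extension. -/
noncomputable def extInclLinear :
    RepModule (regularRep G K) →ₗ[Unitization K (LPA K G)] ExtCarrier c hp θ hθ where
  toFun a := RepModule.of _ ((RepModule.of _).symm a, 0)
  map_add' a b := by
    rw [← map_add, Prod.mk_add_mk, add_zero, map_add]
  map_smul' z a := by
    obtain ⟨a, rfl⟩ := (RepModule.of _).surjective a
    simp [RepModule.smul_of, extRep_inl]

/-- The projection of the extension onto `V^p_{[c^∞]}`. -/
noncomputable def extProjLinear :
    ExtCarrier c hp θ hθ →ₗ[Unitization K (LPA K G)] SimpleCarrier c hp where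
  toFun y := SimpleCarrier.of c hp ((RepModule.of _).symm y).2
  map_add' _ _ := by simp
  map_smul' z y := by
    obtain ⟨y, rfl⟩ := (RepModule.of _).surjective y
    simp [RepModule.smul_of, SimpleCarrier.smul_of, extRep_snd, simpleRepK_apply]

lemma extInclLinear_injective : Function.Injective (extInclLinear c hp θ hθ) := fun _ _ h =>
  (RepModule.of _).symm.injective (congrArg Prod.fst ((RepModule.of _).injective h))

lemma extProjLinear_surjective : Function.Surjective (extProjLinear c hp θ hθ) := fun z =>
  ⟨RepModule.of _ (0, (SimpleCarrier.of c hp).symm z), rfl⟩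

lemma exists_extInclLinear_eq (y : ExtCarrier c hp θ hθ) (hy : extProjLinear c hp θ hθ y = 0) :
    ∃ a, extInclLinear c hp θ hθ a = y := by
  obtain ⟨y, rfl⟩ := (RepModule.of _).surjective y
  exact ⟨RepModule.of _ y.1, congrArg (RepModule.of _) (Prod.ext rfl (Eq.symm hy))⟩

/-- The short exact sequence `0 → L_K(G) → P → V^p_{[c^∞]} → 0`, with `P` the extension given
by `θ`. -/
noncomputable def extComplex : ShortComplex (LMod G K) where
  X₁ := regularModule G K
  X₂ := extModule c hp θ hθ
  X₃ := simpleModule c hp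
  f := (isUnital G K).homMk (ModuleCat.ofHom (extInclLinear c hp θ hθ))
  g := (isUnital G K).homMk (ModuleCat.ofHom (extProjLinear c hp θ hθ))
  zero := by ext x; rfl

lemma extComplex_shortExact : (extComplex c hp θ hθ).ShortExact := by
  have : (isUnital G K).ι.PreservesHomology :=
    ⟨fun _ _ f => (isUnital G K).preservesKernels_ι f,
      fun _ _ f => (isUnital G K).preservesCokernels_ι f⟩
  have hmap : ((extComplex c hp θ hθ).map (isUnital G K).ι).ShortExact :=
    { exact := by
        rw [ShortComplex.moduleCat_exact_iff]
        exact exists_extInclLinear_eq c hp θ hθ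
      mono_f := by
        rw [ModuleCat.mono_iff_injective]
        exact extInclLinear_injective c hp θ hθ
      epi_g := by
        rw [ModuleCat.epi_iff_surjective]
        exact extProjLinear_surjective c hp θ hθ }
  have := hmap.mono_f
  have := hmap.epi_g
  exact
    { exact := (ShortComplex.exact_map_iff_of_faithful _ (isUnital G K).ι).1 hmap.exact
      mono_f := (isUnital G K).ι.mono_of_mono_map hmap.mono_f
      epi_g := (isUnital G K).ι.epi_of_epi_map hmap.epi_g }

variable (e : G.Cyc) {q : K[X]} (hq : IsBasicIrreducible q)

/-- The homomorphism `L_K(G) → V^q_{[e^∞]}`, `a ↦ a m`. -/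
noncomputable def orbitLinear (m : TailClass e →₀ AdjoinRoot q) :
    RepModule (regularRep G K) →ₗ[Unitization K (LPA K G)] SimpleCarrier e hq where
  toFun a := SimpleCarrier.of e hq (simpleRep e hq ((RepModule.of _).symm a) m)
  map_add' a b := by simp
  map_smul' z a := by
    obtain ⟨a, rfl⟩ := (RepModule.of _).surjective a
    simp [RepModule.smul_of, SimpleCarrier.smul_of, Module.End.mul_apply]

/-- The homomorphism `L_K(G) → V^q_{[e^∞]}`, `a ↦ a m`, in the category of unital modules. -/
noncomputable def orbitHom (m : TailClass e →₀ AdjoinRoot q) :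
    regularModule G K ⟶ simpleModule e hq :=
  (isUnital G K).homMk (ModuleCat.ofHom (orbitLinear e hq m))

lemma orbitHom_add (m m' : TailClass e →₀ AdjoinRoot q) :
    orbitHom e hq (m + m') = orbitHom e hq m + orbitHom e hq m' := by
  ext a
  exact congrArg (SimpleCarrier.of e hq) (map_add (simpleRep e hq _) m m')

lemma orbitHom_smul (k : K) (m : TailClass e →₀ AdjoinRoot q) :
    orbitHom e hq (k • m) = k • orbitHom e hq m := by
  ext a
  refine Eq.trans ?_ (SimpleCarrier.inl_smul_of e hq k _).symm
  exact congrArg (SimpleCarrier.of e hq) (LinearMap.map_smul_of_tower (simpleRep e hq _) k m)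

/-- The class of the extension of `V^p_{[c^∞]}` by `L_K(G)` given by `θ`. -/
noncomputable def extensionClass : Abelian.Ext (simpleModule c hp) (regularModule G K) 1 :=
  (extComplex_shortExact c hp θ hθ).extClass

/-- The connecting homomorphism: `m` is sent to the class of the pushout of the extension along
`L_K(G) → V^q_{[e^∞]}`, `a ↦ a m`. -/
noncomputable def connecting : (TailClass e →₀ AdjoinRoot q) →ₗ[K]
    Abelian.Ext (simpleModule c hp) (simpleModule e hq) 1 where
  toFun m := (extensionClass c hp θ hθ).comp (Abelian.Ext.mk₀ (orbitHom e hq m)) (add_zero 1)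
  map_add' m m' := by rw [orbitHom_add, Abelian.Ext.mk₀_add, Abelian.Ext.comp_add]
  map_smul' k m := by
    rw [orbitHom_smul, Abelian.Ext.mk₀_smul, Abelian.Ext.comp_smul, RingHom.id_apply]

/-- If the connecting homomorphism vanishes on `m`, then `a ↦ a m` extends to the middle term, and
the restriction `h` of such an extended map to the summand `V^p_{[c^∞]}` is compatible with the edges
up to the terms given by `θ`. -/
lemma exists_of_connecting_eq_zero {m : TailClass e →₀ AdjoinRoot q}
    (hm : connecting c hp θ hθ e hq m = 0) :
    ∃ h : (TailClass c →₀ AdjoinRoot p) →ₗ[K] (TailClass e →₀ AdjoinRoot q),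
      ∀ f z, h (simpleRep c hp (LPA.gen K (.edge f)) z) +
        simpleRep e hq (LPA.gen K (.edge f)) (simpleRep e hq (θ f z) m) =
          simpleRep e hq (LPA.gen K (.edge f)) (h z) := by
  obtain ⟨x, hx⟩ := Abelian.Ext.contravariant_sequence_exact₁ (extComplex_shortExact c hp θ hθ)
    (Y := simpleModule e hq) (Abelian.Ext.mk₀ (orbitHom e hq m)) (add_zero 1) hm
  obtain ⟨g, rfl⟩ := Abelian.Ext.mk₀_bijective _ _ |>.2 x
  rw [Abelian.Ext.mk₀_comp_mk₀] at hx
  have hx := (Abelian.Ext.mk₀_bijective _ _).1 hx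
  let γ : ExtCarrier c hp θ hθ →ₗ[Unitization K (LPA K G)] SimpleCarrier e hq := g.hom.hom
  -- The composite of `γ` with the identifications of the carriers.
  let δ : LPA K G × (TailClass c →₀ AdjoinRoot p) →+ (TailClass e →₀ AdjoinRoot q) :=
    (SimpleCarrier.of e hq).symm.toAddMonoidHom.comp
      (γ.toAddMonoidHom.comp (RepModule.of _).toAddMonoidHom)
  have hδ : ∀ y, γ (RepModule.of _ y) = SimpleCarrier.of e hq (δ y) := fun y =>
    ((SimpleCarrier.of e hq).apply_symm_apply _).symm
  have hinl : ∀ a : LPA K G, δ (a, 0) = simpleRep e hq a m := fun a =>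
    congrArg (fun φ : regularModule G K ⟶ simpleModule e hq => φ.hom.hom a) hx
  have hrep : ∀ (a : LPA K G) y,
      δ (extRep (regularRep G K) (simpleRepK c hp) θ hθ a y) = simpleRep e hq a (δ y) := by
    intro a y
    apply (SimpleCarrier.of e hq).injective
    rw [← hδ, ← RepModule.inr_smul_of, map_smul, hδ, SimpleCarrier.inr_smul_of]
  have hsmul : ∀ (k : K) y, δ (k • y) = k • δ y := by
    intro k y
    apply (SimpleCarrier.of e hq).injective
    rw [← hδ, ← RepModule.inl_smul_of, map_smul, hδ, SimpleCarrier.inl_smul_of]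
  let h : (TailClass c →₀ AdjoinRoot p) →ₗ[K] (TailClass e →₀ AdjoinRoot q) :=
    { toFun := fun z => δ (0, z)
      map_add' := fun y z => by rw [← map_add, Prod.mk_add_mk, add_zero]
      map_smul' := fun k z => by rw [RingHom.id_apply, ← hsmul, Prod.smul_mk, smul_zero] }
  refine ⟨h, fun f z => ?_⟩
  have h1 := hrep (LPA.gen K (.edge f)) (0, z)
  rw [extRep_edge] at h1
  rw [← hinl, ← hrep, extRep_inl, show h z = δ (0, z) from rfl, ← h1, add_comm]
  change δ _ + δ _ = _
  rw [← map_add, Prod.mk_add_mk, add_zero, zero_add, zero_add]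
  rfl

end Connecting

/-! ### The action of a cycle on the module of another cycle -/

section Action

variable {G : DirGraph.{u, v}} {K : Type w} [Field K] (e : G.Cyc) {q : K[X]}
  (hq : IsBasicIrreducible q)

open Classical in
/-- The factor by which the gauge automorphism multiplies an edge. -/
noncomputable def gaugeUnit (f : G.E) : (AdjoinRoot q)ˣ := if f = e.first then rootUnit hq else 1

open Classical in
lemma simpleRep_vertex_single (v : G.V) (x : TailClass e) (a : AdjoinRoot q) :
    simpleRep e hq (LPA.gen K (.vertex v)) (Finsupp.single x a) =
      if v = x.src then Finsupp.single x a else 0 := by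
  simp only [simpleRep, NonUnitalAlgHom.coe_mk, LPA.baseChange, LPA.lift_gen, LPA.gauge,
    LPA.gaugeFun, chenRep]
  simp [chenFun]

open Classical in
lemma simpleRep_edge_single (f : G.E) (x : TailClass e) (a : AdjoinRoot q) :
    simpleRep e hq (LPA.gen K (.edge f)) (Finsupp.single x a) =
      if h : G.r f = x.src then Finsupp.single (x.cons f h) (gaugeUnit e hq f * a) else 0 := by
  simp only [simpleRep, NonUnitalAlgHom.coe_mk, LPA.baseChange, LPA.lift_gen, LPA.gauge,
    LPA.gaugeFun, chenRep, map_smul]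
  by_cases h : G.r f = x.src <;> by_cases hf : f = e.first <;> simp_all [chenFun, gaugeUnit]

variable (c : G.Cyc)

/-- The action on `V^q_{[e^∞]}` of the path `c₀ c₁ ⋯ c_{i-1}` formed by the first `i` edges
of `c^∞`. -/
noncomputable def pathOp : ℕ → Module.End (AdjoinRoot q) (TailClass e →₀ AdjoinRoot q)
  | 0 => 1
  | i + 1 => pathOp i * simpleRep e hq (LPA.gen K (.edge (c.inf i)))

lemma pathOp_succ_apply (i : ℕ) (y : TailClass e →₀ AdjoinRoot q) :
    pathOp e hq c (i + 1) y = pathOp e hq c i (simpleRep e hq (LPA.gen K (.edge (c.inf i))) y) :=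
  rfl

/-- The action on `V^q_{[e^∞]}` of the cycle `c`. -/
noncomputable abbrev cycleOp : Module.End (AdjoinRoot q) (TailClass e →₀ AdjoinRoot q) :=
  pathOp e hq c c.edges.length

lemma pathOp_single (i : ℕ) (x : TailClass e) (h : x.src = G.s (c.inf i)) (a : AdjoinRoot q) :
    pathOp e hq c i (Finsupp.single x a) = Finsupp.single (x.splice c i h)
      (((∏ j ∈ Finset.range i, gaugeUnit e hq (c.inf j) : (AdjoinRoot q)ˣ) : AdjoinRoot q) * a) := by
  induction i generalizing x a with
  | zero => simp [pathOp, TailClass.splice_zero]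
  | succ i ih =>
    rw [pathOp_succ_apply, simpleRep_edge_single, dif_pos ((c.chain_inf i).trans h.symm), ih _ rfl,
      TailClass.splice_succ, Finset.prod_range_succ, Units.val_mul, mul_assoc]

lemma cycleOp_single_of_ne (x : TailClass e) (h : x.src ≠ c.base) (a : AdjoinRoot q) :
    cycleOp e hq c (Finsupp.single x a) = 0 := by
  obtain ⟨i, hi⟩ := Nat.exists_eq_succ_of_ne_zero c.length_pos.ne'
  rw [cycleOp, hi, pathOp_succ_apply, simpleRep_edge_single, dif_neg, map_zero]
  rw [c.chain_inf, ← Nat.succ_eq_add_one, ← hi, c.inf_length]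
  exact h.symm

/-- The scalar by which `c` multiplies the infinite paths that start at its base, apart from
prepending itself. -/
noncomputable def cycleUnit : (AdjoinRoot q)ˣ :=
  ∏ j ∈ Finset.range c.edges.length, gaugeUnit e hq (c.inf j)

lemma cycleOp_single (x : {x : TailClass e // x.src = c.base}) (a : AdjoinRoot q) :
    cycleOp e hq c (Finsupp.single x.1 a) =
      Finsupp.single (TailClass.around c x).1 (cycleUnit e hq c * a) :=
  pathOp_single e hq c _ _ (x.2.trans (congrArg G.s c.inf_length.symm)) a

lemma edge_ghost_pathOp (i : ℕ) (y : TailClass e →₀ AdjoinRoot q) :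
    simpleRep e hq (LPA.gen K (.edge c.first)) (simpleRep e hq (LPA.gen K (.ghost c.first))
      (pathOp e hq c (i + 1) y)) = pathOp e hq c (i + 1) y := by
  induction i generalizing y with
  | zero =>
    have h := LPA.isLeavittFamily_gen (R := K) (G := G)
    rw [pathOp_succ_apply, c.inf_zero]
    change (simpleRep e hq _ * (simpleRep e hq _ * simpleRep e hq _)) y = simpleRep e hq _ y
    rw [← map_mul, ← map_mul, h.ghost_mul_edge_self, h.edge_mul_range]
  | succ i ih => rw [pathOp_succ_apply, ih]

variable {c} (x : {x : TailClass e // x.src = c.base})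

/-- For an infinite path `x` that does not start with `c`, the coefficients of an element of
`V^q_{[e^∞]}` at the paths `x, c x, c² x, …`, as a polynomial. The coefficients are normalized so
that the action of `c` becomes the multiplication by `X`. -/
noncomputable def orbitPoly : (TailClass e →₀ AdjoinRoot q) →ₗ[AdjoinRoot q] (AdjoinRoot q)[X] :=
  Finsupp.linearCombination (AdjoinRoot q) (Function.extend
    (fun j => ((TailClass.around c)^[j] x).1)
    (fun j => C (((cycleUnit e hq c)⁻¹ ^ j : (AdjoinRoot q)ˣ) : AdjoinRoot q) * X ^ j) 0)

variable {x} (hx : ∃ i < c.edges.length, x.1.seq i ≠ c.inf i)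
include hx

lemma around_ne (y : {x : TailClass e // x.src = c.base}) : TailClass.around c y ≠ x := by
  rintro rfl
  obtain ⟨i, hi, h⟩ := hx
  exact h (TailClass.around_seq y hi)

lemma iterate_around_injective :
    Function.Injective fun j => ((TailClass.around c)^[j] x).1 := by
  have key : ∀ j k, ((TailClass.around c)^[j] x) = ((TailClass.around c)^[k] x) → j ≤ k := by
    intro j
    induction j with
    | zero => exact fun k _ => Nat.zero_le k
    | succ j ih =>
      intro k h
      cases k with
      | zero =>
        rw [Function.iterate_succ_apply'] at h
        exact absurd h (around_ne e hx _)
      | succ k =>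
        rw [Function.iterate_succ_apply', Function.iterate_succ_apply'] at h
        exact Nat.succ_le_succ (ih k (TailClass.around_injective c h))
  exact fun j k h => le_antisymm (key j k (Subtype.ext h)) (key k j (Subtype.ext h.symm))

lemma orbitPoly_single (j : ℕ) (a : AdjoinRoot q) :
    orbitPoly e hq x (Finsupp.single ((TailClass.around c)^[j] x).1 a) =
      a • (C (((cycleUnit e hq c)⁻¹ ^ j : (AdjoinRoot q)ˣ) : AdjoinRoot q) * X ^ j) := by
  rw [orbitPoly, Finsupp.linearCombination_single, (iterate_around_injective e hx).extend_apply]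

omit hx in
lemma orbitPoly_single_of_ne {z : TailClass e} (hz : ∀ j, ((TailClass.around c)^[j] x).1 ≠ z)
    (a : AdjoinRoot q) : orbitPoly e hq x (Finsupp.single z a) = 0 := by
  rw [orbitPoly, Finsupp.linearCombination_single,
    Function.extend_apply' _ _ _ (fun ⟨j, hj⟩ => hz j hj), Pi.zero_apply, smul_zero]

lemma orbitPoly_cycleOp (y : TailClass e →₀ AdjoinRoot q) :
    orbitPoly e hq x (cycleOp e hq c y) = X * orbitPoly e hq x y := by
  induction y using Finsupp.induction_linear with
  | zero => simp
  | add y z hy hz => rw [map_add, map_add, hy, hz, map_add, mul_add]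
  | single z a =>
    by_cases hz : ∃ j, ((TailClass.around c)^[j] x).1 = z
    · obtain ⟨j, rfl⟩ := hz
      rw [cycleOp_single, ← Function.iterate_succ_apply' (TailClass.around c),
        orbitPoly_single e hq hx, orbitPoly_single e hq hx, mul_smul_comm, mul_left_comm,
        ← pow_succ', smul_eq_C_mul, smul_eq_C_mul, ← mul_assoc, ← mul_assoc, ← C_mul, ← C_mul,
        mul_comm _ a, mul_assoc a, ← Units.val_mul, pow_succ', mul_inv_cancel_left]
    · push Not at hz
      rw [orbitPoly_single_of_ne e hq hz, mul_zero]
      by_cases hb : z.src = c.base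
      · rw [cycleOp_single e hq c ⟨z, hb⟩, orbitPoly_single_of_ne]
        rintro (_ | j) h
        · exact around_ne e hx _ (Subtype.ext h.symm)
        · rw [Function.iterate_succ_apply'] at h
          exact hz j (congrArg Subtype.val (TailClass.around_injective c (Subtype.ext h)))
      · rw [cycleOp_single_of_ne e hq c z hb, map_zero]

lemma orbitPoly_aeval (P : K[X]) (y : TailClass e →₀ AdjoinRoot q) :
    orbitPoly e hq x (aeval (cycleOp e hq c) P y) =
      P.map (algebraMap K (AdjoinRoot q)) * orbitPoly e hq x y := by
  induction P using Polynomial.induction_on' with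
  | add P Q hP hQ => rw [map_add, LinearMap.add_apply, map_add, hP, hQ, Polynomial.map_add, add_mul]
  | monomial n k =>
    have hpow : ∀ n : ℕ, orbitPoly e hq x ((cycleOp e hq c ^ n) y) = X ^ n * orbitPoly e hq x y := by
      intro n
      induction n with
      | zero => simp
      | succ n ih => rw [pow_succ', Module.End.mul_apply, orbitPoly_cycleOp e hq hx, ih, pow_succ',
          mul_assoc]
    rw [aeval_monomial, Module.End.mul_apply, Module.algebraMap_end_apply,
      LinearMap.map_smul_of_tower, hpow, Polynomial.map_monomial, ← C_mul_X_pow_eq_monomial,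
      mul_assoc, ← smul_eq_C_mul, algebraMap_smul]

end Action

/-! ### The obstruction to splitting -/

section Obstruction

variable {G : DirGraph.{u, v}} {K : Type w} [Field K] (c : G.Cyc) {p : K[X]}
  (hp : IsBasicIrreducible p)

open Classical in
/-- The linear maps defining the extension, for a linear form `τ` on `K' = K[x]/⟨p(x)⟩`. Only the
first edge `c₀` is twisted, by the map that sends an element of `V^p_{[c^∞]}` to the multiple of the
vertex `r(c₀)` by the value of `τ` at its coefficient at the infinite path `c₁ c₂ ⋯`. -/
noncomputable def edgeTwist (τ : AdjoinRoot p →ₗ[K] K) (f : G.E) :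
    (TailClass c →₀ AdjoinRoot p) →ₗ[K] LPA K G :=
  if f = c.first then
    (τ ∘ₗ (Finsupp.lapply (R := AdjoinRoot p) (TailClass.infFrom c 1)).restrictScalars K).smulRight
      (LPA.gen K (.vertex (G.r f)))
  else 0

variable (τ : AdjoinRoot p →ₗ[K] K)

lemma edgeTwist_first (z : TailClass c →₀ AdjoinRoot p) :
    edgeTwist c τ c.first z = τ (z (TailClass.infFrom c 1)) • LPA.gen K (.vertex (G.r c.first)) := by
  simp [edgeTwist]

lemma edgeTwist_of_ne {f : G.E} (hf : f ≠ c.first) : edgeTwist c τ f = 0 := if_neg hf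

lemma edgeTwist_vertex (f : G.E) (z : TailClass c →₀ AdjoinRoot p) :
    edgeTwist c τ f (simpleRepK c hp (LPA.gen K (.vertex (G.r f))) z) =
      regularRep G K (LPA.gen K (.vertex (G.r f))) (edgeTwist c τ f z) := by
  by_cases hf : f = c.first
  · subst hf
    rw [edgeTwist_first, edgeTwist_first, map_smul, NonUnitalAlgHom.coe_lmul_eq_mul,
      LinearMap.mul_apply', LPA.isLeavittFamily_gen.vertex_mul_self]
    congr 2
    rw [simpleRepK_apply]
    induction z using Finsupp.induction_linear with
    | zero => simp
    | add y z hy hz => rw [map_add, Finsupp.add_apply, hy, hz, Finsupp.add_apply]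
    | single x a =>
      rw [simpleRep_vertex_single]
      split_ifs with h
      · rfl
      · rw [Finsupp.single_eq_of_ne, Finsupp.zero_apply]
        rintro rfl
        exact h (c.inf_zero ▸ c.chain_inf 0)
  · simp [edgeTwist_of_ne c τ hf]

variable (e : G.Cyc) {q : K[X]} (hq : IsBasicIrreducible q)

/-- The class attached to an element `m` of `V^q_{[e^∞]}`, for a linear form `τ`. -/
noncomputable abbrev cycleClass : (TailClass e →₀ AdjoinRoot q) →ₗ[K]
    Abelian.Ext (simpleModule c hp) (simpleModule e hq) 1 :=
  connecting c hp (edgeTwist c τ) (edgeTwist_vertex c hp τ) e hq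

lemma simpleRep_edge_infFrom (i : ℕ) (k : AdjoinRoot p) :
    simpleRep c hp (LPA.gen K (.edge (c.inf i))) (Finsupp.single (TailClass.infFrom c (i + 1)) k) =
      Finsupp.single (TailClass.infFrom c i) (gaugeUnit c hp (c.inf i) * k) := by
  have h : G.r (c.inf i) = (TailClass.infFrom c (i + 1)).src := c.chain_inf i
  rw [simpleRep_edge_single, dif_pos h, TailClass.cons_infFrom]

/-- In `V^p_{[c^∞]}` the cycle `c` multiplies `c^∞` by `x̄`. If the class attached to `m` vanishes,
then in `V^q_{[e^∞]}` this relation is deformed by a multiple of `c₀ m`. -/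
lemma exists_of_cycleClass_eq_zero {m : TailClass e →₀ AdjoinRoot q}
    (hm : cycleClass c hp τ e hq m = 0) :
    ∃ y : AdjoinRoot p →ₗ[K] (TailClass e →₀ AdjoinRoot q), ∀ k,
      cycleOp e hq c (y k) = y (AdjoinRoot.root p * k) +
        τ k • simpleRep e hq (LPA.gen K (.edge c.first)) m := by
  obtain ⟨h, hh⟩ := exists_of_connecting_eq_zero _ _ _ _ _ _ hm
  have key : ∀ i < c.edges.length, ∀ k,
      pathOp e hq c (i + 1) (h (Finsupp.single (TailClass.infFrom c (i + 1)) k)) =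
        h (Finsupp.single (TailClass.infFrom c 0) (AdjoinRoot.root p * k)) +
          τ k • simpleRep e hq (LPA.gen K (.edge c.first)) m := by
    intro i hi k
    induction i with
    | zero =>
      rw [pathOp_succ_apply, ← hh, simpleRep_edge_infFrom, c.inf_zero, edgeTwist_first, gaugeUnit, if_pos rfl,
        Finsupp.single_eq_same, map_smul, LinearMap.smul_apply, LinearMap.map_smul_of_tower,
        ← Module.End.mul_apply, ← map_mul, LPA.isLeavittFamily_gen.edge_mul_range]
      rfl
    | succ i ih =>
      have hne := c.inf_ne_first i.succ_pos hi
      rw [pathOp_succ_apply, ← hh, simpleRep_edge_infFrom,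
        edgeTwist_of_ne c τ hne, gaugeUnit, if_neg hne,
        LinearMap.zero_apply, map_zero, LinearMap.zero_apply, map_zero, add_zero, Units.val_one,
        one_mul]
      exact ih (Nat.lt_of_succ_lt hi)
  refine ⟨h ∘ₗ (Finsupp.lsingle (R := AdjoinRoot p) (TailClass.infFrom c 0)).restrictScalars K,
    fun k => ?_⟩
  obtain ⟨i, hi⟩ := Nat.exists_eq_succ_of_ne_zero c.length_pos.ne'
  have := key i (by omega) k
  rw [← Nat.succ_eq_add_one, ← hi, TailClass.infFrom_length] at this
  exact this

include hp in
/-- The linear form on `K[x]/⟨p(x)⟩` that reads off the coefficient of the highest power. -/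
lemma exists_linearForm : ∃ τ : AdjoinRoot p →ₗ[K] K,
    (∀ i, i + 1 < p.natDegree → τ (AdjoinRoot.root p ^ i) = 0) ∧
      τ (AdjoinRoot.root p ^ (p.natDegree - 1)) = 1 := by
  have h0 := hp.irreducible.ne_zero
  have h2 := hp.two_le_natDegree
  let B := AdjoinRoot.powerBasis h0
  have hdim : B.dim = p.natDegree := AdjoinRoot.powerBasis_dim h0
  have hgen : ∀ i : Fin B.dim, B.basis i = AdjoinRoot.root p ^ (i : ℕ) := fun i => by
    rw [B.basis_eq_pow, AdjoinRoot.powerBasis_gen]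
  refine ⟨B.basis.coord ⟨p.natDegree - 1, by omega⟩, fun i hi => ?_, ?_⟩
  · rw [← hgen ⟨i, by omega⟩, Module.Basis.coord_apply, Module.Basis.repr_self,
      Finsupp.single_eq_of_ne]
    exact fun h => by have := congrArg Fin.val h; simp only at this; omega
  · rw [← hgen ⟨p.natDegree - 1, by omega⟩, Module.Basis.coord_apply, Module.Basis.repr_self,
      Finsupp.single_eq_same]

/-- If the class attached to `m` vanishes, then `c₀ m` lies in the image of `p(c)`. -/
lemma exists_aeval_eq_of_cycleClass_eq_zero
    (hτ : ∀ i, i + 1 < p.natDegree → τ (AdjoinRoot.root p ^ i) = 0)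
    (hτ' : τ (AdjoinRoot.root p ^ (p.natDegree - 1)) = 1) {m : TailClass e →₀ AdjoinRoot q}
    (hm : cycleClass c hp τ e hq m = 0) :
    ∃ y, aeval (cycleOp e hq c) p y =
      p.leadingCoeff • simpleRep e hq (LPA.gen K (.edge c.first)) m := by
  obtain ⟨y, hy⟩ := exists_of_cycleClass_eq_zero c hp τ e hq hm
  have h2 := hp.two_le_natDegree
  have hpow : ∀ i, i < p.natDegree → (cycleOp e hq c ^ i) (y 1) = y (AdjoinRoot.root p ^ i) := by
    intro i
    induction i with
    | zero => intro; rw [pow_zero, pow_zero, Module.End.one_apply]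
    | succ i ih =>
      intro hi
      rw [pow_succ', Module.End.mul_apply, ih (by omega), hy, hτ i hi, zero_smul, add_zero,
        pow_succ']
  have hlast : (cycleOp e hq c ^ p.natDegree) (y 1) = y (AdjoinRoot.root p ^ p.natDegree) +
      simpleRep e hq (LPA.gen K (.edge c.first)) m := by
    obtain ⟨d, hd⟩ : ∃ d, p.natDegree = d + 1 := ⟨p.natDegree - 1, by omega⟩
    rw [hd, Nat.add_sub_cancel] at hτ'
    rw [hd, pow_succ', Module.End.mul_apply, hpow d (by omega), hy, hτ', one_smul, pow_succ']
  refine ⟨y 1, ?_⟩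
  have hroot : y (aeval (AdjoinRoot.root p) p) = 0 := by
    rw [AdjoinRoot.aeval_eq, AdjoinRoot.mk_self, map_zero]
  rw [aeval_eq_sum_range, map_sum] at hroot
  rw [aeval_eq_sum_range, LinearMap.sum_apply, ← sub_zero (∑ i ∈ _, _), ← hroot,
    Finset.sum_range_succ, Finset.sum_range_succ, Finset.sum_congr rfl fun i hi => ?_]
  · rw [LinearMap.smul_apply, hlast, map_smul, smul_add, leadingCoeff]
    abel
  · rw [LinearMap.smul_apply, hpow i (Finset.mem_range.1 hi), map_smul]

/-- The infinite paths of the class `[e^∞]` that start at the base of `c` but not with `c`. -/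
abbrev Deviating : Type (max u v) :=
  {x : TailClass e // x.src = c.base ∧ ∃ i < c.edges.length, x.seq i ≠ c.inf i}

variable (q) in
/-- The inclusion of the `K`-linear combinations of deviating paths in `V^q_{[e^∞]}`. -/
noncomputable def deviatingIncl : (Deviating c e →₀ K) →ₗ[K] (TailClass e →₀ AdjoinRoot q) :=
  Finsupp.linearCombination K fun x => Finsupp.single x.1 1

lemma orbitPoly_deviatingIncl (x : Deviating c e) (s : Deviating c e →₀ K) :
    orbitPoly e hq (c := c) ⟨x.1, x.2.1⟩ (deviatingIncl c e q s) =
      C (algebraMap K (AdjoinRoot q) (s x)) := by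
  induction s using Finsupp.induction_linear with
  | zero => simp
  | add s t hs ht => rw [map_add, map_add, hs, ht, Finsupp.add_apply, map_add, map_add]
  | single y a =>
    rw [deviatingIncl, Finsupp.linearCombination_single, LinearMap.map_smul_of_tower]
    by_cases hxy : x = y
    · subst hxy
      have := orbitPoly_single e hq (c := c) (x := ⟨x.1, x.2.1⟩) x.2.2 0 1
      rw [Function.iterate_zero_apply] at this
      rw [this, Finsupp.single_eq_same]
      simp [Algebra.smul_def]
    · rw [orbitPoly_single_of_ne, smul_zero, Finsupp.single_eq_of_ne hxy, map_zero, map_zero]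
      rintro (_ | j) h
      · exact hxy (Subtype.ext h)
      · rw [Function.iterate_succ_apply'] at h
        exact around_ne e (x := ⟨y.1, y.2.1⟩) y.2.2 _ (Subtype.ext h)

include hp in
/-- No nonzero combination `s` of deviating paths has `c s` in the image of `p(c)`: compare the
degrees of the polynomials attached to the orbit of a path. Here `deg p ≥ 2` is used. -/
lemma eq_zero_of_aeval_eq {s : Deviating c e →₀ K} {y : TailClass e →₀ AdjoinRoot q}
    (hy : aeval (cycleOp e hq c) p y =
      p.leadingCoeff • cycleOp e hq c (deviatingIncl c e q s)) : s = 0 := by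
  have := Fact.mk hq.irreducible
  ext x
  by_contra hs
  rw [Finsupp.zero_apply] at hs
  have h := congrArg (orbitPoly e hq (c := c) ⟨x.1, x.2.1⟩) hy
  rw [orbitPoly_aeval e hq x.2.2, LinearMap.map_smul_of_tower, orbitPoly_cycleOp e hq x.2.2,
    orbitPoly_deviatingIncl, ← algebraMap_smul (AdjoinRoot q), smul_eq_C_mul, mul_left_comm,
    ← C_mul, ← map_mul] at h
  have hne : algebraMap K (AdjoinRoot q) (p.leadingCoeff * s x) ≠ 0 :=
    (_root_.map_ne_zero _).2 (mul_ne_zero (leadingCoeff_ne_zero.2 hp.irreducible.ne_zero) hs)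
  have h0 : X * C (algebraMap K (AdjoinRoot q) (p.leadingCoeff * s x)) ≠ 0 :=
    mul_ne_zero X_ne_zero (C_ne_zero.2 hne)
  have hdeg := congrArg natDegree h
  rw [natDegree_X_mul (C_ne_zero.2 hne), natDegree_C, natDegree_mul (left_ne_zero_of_mul (h ▸ h0))
    (right_ne_zero_of_mul (h ▸ h0)), natDegree_map] at hdeg
  have := hp.two_le_natDegree
  omega

/-- The linear map from the space with basis the deviating paths to the extension space that sends
`s` to the class attached to `m = c₀* c s`, which satisfies `c₀ m = c s`. -/
noncomputable def deviatingClass : (Deviating c e →₀ K) →ₗ[K]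
    Abelian.Ext (simpleModule c hp) (simpleModule e hq) 1 :=
  cycleClass c hp τ e hq ∘ₗ
    ((simpleRep e hq (LPA.gen K (.ghost c.first)) * cycleOp e hq c).restrictScalars K) ∘ₗ
      deviatingIncl c e q

lemma deviatingClass_injective
    (hτ : ∀ i, i + 1 < p.natDegree → τ (AdjoinRoot.root p ^ i) = 0)
    (hτ' : τ (AdjoinRoot.root p ^ (p.natDegree - 1)) = 1) :
    Function.Injective (deviatingClass c hp τ e hq) := by
  rw [injective_iff_map_eq_zero]
  intro s hs
  obtain ⟨y, hy⟩ := exists_aeval_eq_of_cycleClass_eq_zero c hp τ e hq hτ hτ' hs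
  obtain ⟨i, hi⟩ := Nat.exists_eq_succ_of_ne_zero c.length_pos.ne'
  refine eq_zero_of_aeval_eq c hp e hq (hy.trans (congrArg _ ?_))
  rw [cycleOp, hi]
  exact edge_ghost_pathOp e hq c i _

end Obstruction

end DirGraph

theorem mainTheorem3 {K : Type w} [Field K] (G : DirGraph.{u, v}) (c e : G.Cyc) (p q : K[X])
    (hp : DirGraph.IsBasicIrreducible p) (hq : DirGraph.IsBasicIrreducible q)
    (hpath : G.Reaches c.base e.base) (hce : ¬ (c.IsExclusive ∧ e.IsExclusive)) :
    ¬ FiniteDimensional K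
      (Abelian.Ext (DirGraph.simpleModule c hp) (DirGraph.simpleModule e hq) 1) := by
  intro hfin
  have hinf := DirGraph.infinite_deviating hpath hce
  obtain ⟨τ, hτ, hτ'⟩ := DirGraph.exists_linearForm hp
  have : Module.Finite K (DirGraph.Deviating c e →₀ K) := Module.Finite.of_injective
    (DirGraph.deviatingClass c hp τ e hq) (DirGraph.deviatingClass_injective c hp τ e hq hτ hτ')
  exact hinf.not_finite (Module.finite_finsupp_self_iff.1 this |>.resolve_left
    (not_subsingleton K))
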